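/- Let $V_1,\dots,V_n$ be complete $\mathcal{C}^2$ vector fields on $\mathbb{R}^d$ with flows $\varphi^{(1)},\dots,\varphi^{(n)}$, let $V=\sum_{k=1}^n V_k$, and let $\Psi$ be the flow of $\dot x=V(x)$. For $s=(s_1,\dots,s_n)\in\mathbb{R}^n$ put $\Phi_s=\varphi^{(n)}_{s_n}\circ\cdots\circ\varphi^{(1)}_{s_1}$, and let the orbit $\mathcal{X}(x)$ of $x\in\mathbb{R}^d$ be the set of all points $\Phi_{s^{(m)}}\circ\cdots\circ\Phi_{s^{(1)}}(x)$ with $m\ge 0$ and $s^{(1)},\dots,s^{(m)}\in\mathbb{R}^n$. For $h>0$ define $$P_hf(x)=\mathbb{E}\,f(\Phi_{h\tau}(x)),\qquad S_tf(x)=f(\Psi_t(x)),$$ where $\tau=(\tau_1,\dots,\tau_n)$ are independent exponential random variables with mean $1$; $P_h^m$ is the $m$-th iterate of $P_h$. Assume that $\mathcal{X}(x)$ is bounded for every $x\in\mathbb{R}^d$. Fix an orbit $\mathcal{X}=\mathcal{X}(x_0)$, which is an immersed $\mathcal{C}^2$ submanifold of $\mathbb{R}^d$, with the Riemannian metric induced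 by $\mathbb{R}^d$. For $f\in\mathcal{C}^2(\mathcal{X})$ let $\|f\|_2=\sup_{x\in\mathcal{X}}\max\{|f(x)|,\|Df(x)\|,\|D^2f(x)\|\}$, where $Df(x)$ and $D^2f(x)$ are the differential and the Riemannian Hessian of $f$, as a linear and a bilinear form on $T_x\mathcal{X}$, with their operator norms; let $\|g\|_0=\sup_{x\in\mathcal{X}}|g(x)|$, and for a linear operator $L$ let $\|L\|_{2\to0}=\sup\{\|Lf\|_0 : f\in\mathcal{C}^2(\mathcal{X}),\ \|f\|_2=1\}$. Then for every $t>0$ there are constants $C(t)$ and $h_0>0$, not depending on $h$ or $m$, such that $$\|P_h^m-S_t\|_{2\to0}\le C(t)\,h$$ for all $h\in(0,h_0)$ and $m\in\mathbb{N}$ with $mh=t$. (The constants may depend on the vector fields and on the orbit.) -/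

import Mathlib

open MeasureTheory ProbabilityTheory
open scoped ENNReal

set_option maxSynthPendingDepth 3

noncomputable section

namespace RandomSplitting

/-- The phase space `ℝ^d` with its Euclidean norm. -/
abbrev Space (d : ℕ) : Type := EuclideanSpace ℝ (Fin d)

/-! ### Flows -/

section Flows

variable {d n : ℕ}

/-- `γ` is an integral curve of `W`, defined for all times, starting from `x`. -/
def IsGlobalSolution (W : Space d → Space d) (x : Space d) (γ : ℝ → Space d) : Prop :=
  γ 0 = x ∧ ∀ s : ℝ, HasDerivAt γ (W (γ s)) s

/-- A vector field is complete if its integral curve from any point exists for all time. -/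
def IsComplete (W : Space d → Space d) : Prop :=
  ∀ x : Space d, ∃ γ : ℝ → Space d, IsGlobalSolution W x γ

open Classical in
/-- The flow `(t, x) ↦ γ t`, with `γ` the global solution of `γ' = W(γ)`, `γ 0 = x` (unique for the
`C^2` vector fields considered here).  Where no global solution exists the value is junk. -/
def flow (W : Space d → Space d) (t : ℝ) (x : Space d) : Space d :=
  if hx : ∃ γ : ℝ → Space d, IsGlobalSolution W x γ then hx.choose t else x

/-- The sum `V = V_1 + ⋯ + V_n`, whose flow is the true dynamics. -/
def totalField (V : Fin n → Space d → Space d) : Space d → Space d :=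
  fun x => ∑ k, V k x

/-- One cycle `φ^{(n)}_{t_n} ∘ ⋯ ∘ φ^{(1)}_{t_1}` applied to `x` (the first field acts first). -/
def cycle (V : Fin n → Space d → Space d) (t : Fin n → ℝ) (x : Space d) : Space d :=
  (List.finRange n).foldl (fun y k => flow (V k) (t k) y) x

/-- The orbit of `x`: all points reached from `x` by finitely many cycles, over arbitrary positive,
zero or negative times.  The list `ts` holds the time vectors of the successive cycles. -/
def orbit (V : Fin n → Space d → Space d) (x : Space d) : Set (Space d) :=
  {y | ∃ ts : List (Fin n → ℝ), y = ts.foldl (fun z t => cycle V t z) x}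

/-! ### The two semigroups, acting on functions -/

/-- The transition operator `P_h f(x) = E f(Φ_{hτ}(x))`, with `τ = (τ_1, …, τ_n)` independent
exponential random variables of mean one. -/
def transitionOp (V : Fin n → Space d → Space d) (h : ℝ) (f : Space d → ℝ) : Space d → ℝ :=
  fun x => ∫ τ : Fin n → ℝ, f (cycle V (fun k => h * τ k) x)
    ∂(Measure.pi fun _ : Fin n => expMeasure 1)

/-- The semigroup `S_t f(x) = f(Ψ_t(x))` of the true dynamics. -/
def trueSemigroup (V : Fin n → Space d → Space d) (t : ℝ) (f : Space d → ℝ) : Space d → ℝ :=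
  fun x => f (flow (totalField V) t x)

end Flows

/-! ### Differential calculus on an orbit

An orbit `X` is a weakly embedded (initial) `C^2` submanifold of `ℝ^d`: a `C^2` map into `ℝ^d` with
values in the set `X` is a `C^2` map into the manifold `X`.  So the manifold notions on `X` are
read off from the `C^2` maps `F : ℝ^p → X`, among which are the (inverse) charts of `X`.
`X` carries the Riemannian metric induced by `ℝ^d`.
Below `E` is the ambient Euclidean space `ℝ^d`, and
a function on `X` is represented by a function on `E`, of which only the values on `X` matter. -/

section Calculus

variable {E : Type*} [NormedAddCommGroup E] [InnerProductSpace ℝ E] [FiniteDimensional ℝ E]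

/-- `F : ℝ^p → E` is `C^2` with values in `X`. -/
def IsC2MapInto (X : Set E) {p : ℕ} (F : (Fin p → ℝ) → E) : Prop :=
  ContDiff ℝ 2 F ∧ ∀ u, F u ∈ X

/-- The tangent space `T_x X`, generated by the velocities at `x` of the curves in `X`. -/
def tangentSpace (X : Set E) (x : E) : Submodule ℝ E :=
  Submodule.span ℝ {v | ∃ γ : ℝ → E,
    ContDiff ℝ 2 γ ∧ (∀ s, γ s ∈ X) ∧ γ 0 = x ∧ deriv γ 0 = v}

/-- The orthogonal projection of `E` onto `T_x X`. -/
def tangentProj (X : Set E) (x : E) : E →L[ℝ] tangentSpace X x :=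
  (tangentSpace X x).orthogonalProjectionOnto

/-- `L` is the first derivative of `f : X → ℝ` at `x`: the chain rule
`D(f ∘ F)(0) w = L (DF(0) w)` holds for all `C^2` maps `F` into `X` with `F(0) = x`.
(`DF(0) w` lies in `T_x X`; the projection only records this.) -/
def IsFirstDerivAt (X : Set E) (f : E → ℝ) (x : E)
    (L : tangentSpace X x →L[ℝ] ℝ) : Prop :=
  ∀ (p : ℕ) (F : (Fin p → ℝ) → E), IsC2MapInto X F → F 0 = x →
    ∀ w : Fin p → ℝ,
      fderiv ℝ (fun u => f (F u)) 0 w = L (tangentProj X x (fderiv ℝ F 0 w))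

/-- `Q` is the second (covariant) derivative, i.e. the Riemannian Hessian, of `f : X → ℝ` at `x`,
where `L` is the first derivative: the second order chain rule
`D²(f ∘ F)(0)(w, w') = Q(DF(0) w, DF(0) w') + L(∇DF(0)(w, w'))` holds for all `C^2` maps `F` into `X`
with `F(0) = x`.  By the Gauss formula, the covariant second derivative `∇DF(0)(w, w')` of `F` as a
map into `X` is the tangential part of the Euclidean one, `D²F(0)(w, w')`.
On an open set `X` this is the usual second derivative. -/
def IsSecondDerivAt (X : Set E) (f : E → ℝ) (x : E)
    (L : tangentSpace X x →L[ℝ] ℝ)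
    (Q : tangentSpace X x →L[ℝ] tangentSpace X x →L[ℝ] ℝ) : Prop :=
  ∀ (p : ℕ) (F : (Fin p → ℝ) → E), IsC2MapInto X F → F 0 = x →
    ∀ w w' : Fin p → ℝ,
      fderiv ℝ (fderiv ℝ (fun u => f (F u))) 0 w w' =
        Q (tangentProj X x (fderiv ℝ F 0 w)) (tangentProj X x (fderiv ℝ F 0 w')) +
          L (tangentProj X x (fderiv ℝ (fderiv ℝ F) 0 w w'))

/-- `f` belongs to `C^2(X)`: it is `C^2` along every `C^2` map into `X` (in particular in charts),
and has a first and a second derivative at each point of `X`. -/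
def IsC2On (X : Set E) (f : E → ℝ) : Prop :=
  (∀ (p : ℕ) (F : (Fin p → ℝ) → E), IsC2MapInto X F → ContDiff ℝ 2 (fun u => f (F u))) ∧
  ∀ x ∈ X, ∃ L : tangentSpace X x →L[ℝ] ℝ, IsFirstDerivAt X f x L ∧
    ∃ Q : tangentSpace X x →L[ℝ] tangentSpace X x →L[ℝ] ℝ, IsSecondDerivAt X f x L Q

open Classical in
/-- The first derivative `Df(x)`, a linear form on `T_x X`. -/
def firstDeriv (X : Set E) (f : E → ℝ) (x : E) :
    tangentSpace X x →L[ℝ] ℝ :=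
  if hx : ∃ L, IsFirstDerivAt X f x L then hx.choose else 0

open Classical in
/-- The second derivative `D²f(x)`, a bilinear form on `T_x X`. -/
def secondDeriv (X : Set E) (f : E → ℝ) (x : E) :
    tangentSpace X x →L[ℝ] tangentSpace X x →L[ℝ] ℝ :=
  if hx : ∃ Q, IsSecondDerivAt X f x (firstDeriv X f x) Q then hx.choose else 0

/-- `‖f‖_0 = sup_{x ∈ X} |f(x)|`. -/
def c0Norm (X : Set E) (f : E → ℝ) : ℝ≥0∞ :=
  ⨆ x ∈ X, ‖f x‖ₑ

/-- `‖f‖_2`, the supremum over `x ∈ X` of `|f(x)|` and of the operator norms of `Df(x)` and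
`D²f(x)`. -/
def c2Norm (X : Set E) (f : E → ℝ) : ℝ≥0∞ :=
  ⨆ x ∈ X, max ‖f x‖ₑ (max ‖firstDeriv X f x‖ₑ ‖secondDeriv X f x‖ₑ)

/-- `‖L‖_{2 → 0}`, the supremum of `‖L f‖_0` over `f ∈ C^2(X)` with `‖f‖_2 = 1`. -/
def opNormTwoZero (X : Set E) (L : (E → ℝ) → E → ℝ) : ℝ≥0∞ :=
  ⨆ (f : E → ℝ) (_ : IsC2On X f) (_ : c2Norm X f = 1), c0Norm X (L f)

end Calculus

end RandomSplitting

end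

/-!
The proof is the telescoping argument of numerical analysis: a scheme that is consistent to first
order and stable converges to first order.

*Stability.*  `P_h` averages, so it does not increase `‖·‖_0`, and after `m = t / h` steps local
errors of size `C h²` add up to at most `C t h` (`abs_iterate_transitionOp_sub_le`).

*Consistency* (`exists_local_error_bound`).  Fix `f` with `‖f‖_2 ≤ 1`.  Both `P_h S_s f (x)` and
`S_{s+h} f (x)` come from evaluating `f` along a `C^2` map into the orbit, `u ↦ Ψ_s (Φ_u x)` and
`r ↦ Ψ_s (Ψ_r x)` respectively.  The two chain rules bound the first two derivatives of `f` along
such a map by those of the map, which are bounded uniformly for `s ∈ [0, t]` and `x` in the compact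
closure of the orbit.  This gives a Taylor expansion with a uniform quadratic remainder
(`exists_taylor_bound`).  The linear terms cancel after averaging: the derivative of `Φ_u x` at
`u = 0` in the direction `k` is `V_k x`, all times have mean one, and `∑ V_k = V`.

Two facts about flows are needed.  The first is that a complete `C^2` field has a jointly `C^2` flow
(`contDiff_flow`).  For short times it follows from the implicit function theorem in the Banach space
of continuous curves, where composition with a `C^n` map is a `C^n` operator (`contDiff_postcomp`);
the group property of the flow does the rest.

The second is that the true dynamics `Ψ` stays in the orbit (`exists_complete_field`); it is needed
since the values of `f` elsewhere are arbitrary. Among the `C^2` maps into the orbit take one that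
is an immersion at a point, of maximal dimension. Its tangent spaces contain all `V_k`, because
otherwise following the flow of `V_k` would add a dimension; so they contain `V`, and the equation
`x' = V(x)` can be solved in the coordinates of the immersion (`exists_local_solution_mem_orbit`).
The flows of the `V_k` carry the immersion to any other point of the orbit. Hence the times that an
integral curve of `V` spends in an orbit form an open and closed set. As the orbit is bounded, `V`
may be cut off outside a ball around it, and then no question of completeness arises.
-/

namespace RandomSplitting

open Set Filter Topology

/-! ### Uniqueness of integral curves -/

section Uniqueness

variable {E : Type*} [NormedAddCommGroup E] [NormedSpace ℝ E]

theorem eqOn_Icc_of_hasDerivAt {W : E → E} (hW : ContDiff ℝ 1 W) {γ η : ℝ → E} {a b t₀ : ℝ}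
    (ht₀ : t₀ ∈ Ioo a b)
    (hγ : ContinuousOn γ (Icc a b)) (hγ' : ∀ s ∈ Ioo a b, HasDerivAt γ (W (γ s)) s)
    (hη : ContinuousOn η (Icc a b)) (hη' : ∀ s ∈ Ioo a b, HasDerivAt η (W (η s)) s)
    (h : γ t₀ = η t₀) : EqOn γ η (Icc a b) := by
  have hS : IsCompact (γ '' Icc a b ∪ η '' Icc a b) :=
    (isCompact_Icc.image_of_continuousOn hγ).union (isCompact_Icc.image_of_continuousOn hη)
  obtain ⟨K, hK⟩ := LocallyLipschitzOn.exists_lipschitzOnWith_of_compact hS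
    hW.locallyLipschitz.locallyLipschitzOn
  exact ODE_solution_unique_of_mem_Icc (v := fun _ => W) (fun _ _ => hK) ht₀ hγ hγ'
    (fun s hs => Or.inl ⟨s, Ioo_subset_Icc_self hs, rfl⟩) hη hη'
    (fun s hs => Or.inr ⟨s, Ioo_subset_Icc_self hs, rfl⟩) h

theorem eqOn_Ioo_of_hasDerivAt {W : E → E} (hW : ContDiff ℝ 1 W) {γ η : ℝ → E} {a b t₀ : ℝ}
    (ht₀ : t₀ ∈ Ioo a b) (hγ : ∀ s ∈ Ioo a b, HasDerivAt γ (W (γ s)) s)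
    (hη : ∀ s ∈ Ioo a b, HasDerivAt η (W (η s)) s) (h : γ t₀ = η t₀) : EqOn γ η (Ioo a b) := by
  intro s hs
  obtain ⟨a', ha', ha''⟩ := exists_between (lt_min ht₀.1 hs.1)
  obtain ⟨b', hb', hb''⟩ := exists_between (max_lt ht₀.2 hs.2)
  rw [lt_min_iff] at ha''
  rw [max_lt_iff] at hb'
  have hsub : Icc a' b' ⊆ Ioo a b := fun r hr => ⟨ha'.trans_le hr.1, hr.2.trans_lt hb''⟩
  exact eqOn_Icc_of_hasDerivAt hW ⟨ha''.1, hb'.1⟩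
    (fun r hr => (hγ r (hsub hr)).continuousAt.continuousWithinAt)
    (fun r hr => hγ r (hsub (Ioo_subset_Icc_self hr)))
    (fun r hr => (hη r (hsub hr)).continuousAt.continuousWithinAt)
    (fun r hr => hη r (hsub (Ioo_subset_Icc_self hr))) h ⟨ha''.2.le, hb'.2.le⟩

theorem eq_of_hasDerivAt {W : E → E} (hW : ContDiff ℝ 1 W) {γ η : ℝ → E}
    (hγ : ∀ s, HasDerivAt γ (W (γ s)) s) (hη : ∀ s, HasDerivAt η (W (η s)) s)
    (h : γ 0 = η 0) : γ = η := by
  funext s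
  refine eqOn_Ioo_of_hasDerivAt hW (a := -|s| - 1) (b := |s| + 1) (t₀ := 0) ?_ (fun r _ => hγ r)
    (fun r _ => hη r) h ?_
  · constructor <;> linarith [abs_nonneg s]
  · constructor <;> linarith [neg_abs_le s, le_abs_self s]

end Uniqueness

/-! ### Composition with a smooth map, as an operator on continuous functions -/

section Composition

universe u

variable {K : Type*} [TopologicalSpace K] [CompactSpace K]

/-- Pointwise application of a continuous family of linear maps to a continuous function, as a
bounded bilinear operation. -/
noncomputable def pointwiseApply (K : Type*) [TopologicalSpace K] [CompactSpace K] (E F : Type*)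
    [NormedAddCommGroup E] [NormedSpace ℝ E] [NormedAddCommGroup F] [NormedSpace ℝ F] :
    C(K, E →L[ℝ] F) →L[ℝ] C(K, E) →L[ℝ] C(K, F) :=
  LinearMap.mkContinuous₂
    (LinearMap.mk₂ ℝ (fun A β => (⟨fun s => A s (β s), by fun_prop⟩ : C(K, F)))
      (fun _ _ _ => by ext; simp) (fun _ _ _ => by ext; simp)
      (fun _ _ _ => by ext; simp) (fun _ _ _ => by ext; simp)) 1
    (fun A β => by
      rw [one_mul, ContinuousMap.norm_le _ (by positivity)]
      intro s
      exact ((A s).le_opNorm (β s)).trans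
        (mul_le_mul (A.norm_coe_le_norm s) (β.norm_coe_le_norm s) (norm_nonneg _) (norm_nonneg _)))

@[simp]
theorem pointwiseApply_apply {E F : Type*}
    [NormedAddCommGroup E] [NormedSpace ℝ E] [NormedAddCommGroup F] [NormedSpace ℝ F]
    (A : C(K, E →L[ℝ] F)) (β : C(K, E)) (s : K) : pointwiseApply K E F A β s = A s (β s) := rfl

theorem hasFDerivAt_postcomp {E F : Type*}
    [NormedAddCommGroup E] [NormedSpace ℝ E] [NormedAddCommGroup F] [NormedSpace ℝ F]
    (w : C(E, F)) (hw : Differentiable ℝ w) (w' : C(E, E →L[ℝ] F)) (hw' : ∀ x, w' x = fderiv ℝ w x)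
    (α : C(K, E)) :
    HasFDerivAt (fun β : C(K, E) => w.comp β) (pointwiseApply K E F (w'.comp α)) α := by
  rw [hasFDerivAt_iff_isLittleO, Asymptotics.isLittleO_iff]
  intro ε hε
  -- The supremum metric makes `w'` along the segment from `α` to `β` uniformly close to `w' ∘ α`,
  -- and the mean value inequality applies at each point of `K` separately.
  have hcont : ContinuousAt (fun β : C(K, E) => w'.comp β) α :=
    (ContinuousMap.continuous_postcomp w').continuousAt
  obtain ⟨δ, hδ, hball⟩ := Metric.continuousAt_iff.1 hcont ε hε
  filter_upwards [Metric.ball_mem_nhds α hδ] with β hβ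
  rw [ContinuousMap.norm_le _ (by positivity)]
  intro s
  have key := (convex_segment (𝕜 := ℝ) (α s) (β s)).norm_image_sub_le_of_norm_fderiv_le'
    (f := w) (φ := fderiv ℝ w (α s)) (C := ε) (fun x _ => hw x) ?_
    (left_mem_segment ℝ (α s) (β s)) (right_mem_segment ℝ (α s) (β s))
  · simp only [ContinuousMap.sub_apply, ContinuousMap.comp_apply, pointwiseApply_apply, hw']
    refine key.trans (mul_le_mul_of_nonneg_left ?_ hε.le)
    exact (β - α).norm_coe_le_norm s
  · rw [segment_eq_image']
    rintro _ ⟨θ, hθ, rfl⟩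
    have hmem : dist (α + θ • (β - α)) α < δ := by
      rw [dist_eq_norm, add_sub_cancel_left, norm_smul, Real.norm_of_nonneg hθ.1]
      rw [Metric.mem_ball, dist_eq_norm] at hβ
      exact (mul_le_of_le_one_left (norm_nonneg _) hθ.2).trans_lt hβ
    have h1 := (hball hmem).le
    rw [dist_eq_norm] at h1
    have h2 := (ContinuousMap.norm_coe_le_norm _ s).trans h1
    simpa [hw'] using h2

/-- If `w` is `C^n`, then so is the operator `β ↦ w ∘ β` on continuous functions: its derivative is
pointwise multiplication by `Dw ∘ β`, which is an operator of the same kind. -/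
theorem contDiff_postcomp {E : Type u} [NormedAddCommGroup E] [NormedSpace ℝ E] (n : ℕ) :
    ∀ {F : Type u} [NormedAddCommGroup F] [NormedSpace ℝ F] (w : C(E, F)), ContDiff ℝ n w →
      ContDiff ℝ n (fun β : C(K, E) => w.comp β) := by
  induction n with
  | zero =>
    intro F _ _ w _
    exact contDiff_zero.2 (ContinuousMap.continuous_postcomp w)
  | succ n ih =>
    intro F _ _ w hw
    have hw1 : ContDiff ℝ n (fderiv ℝ w) := hw.fderiv_right (by norm_cast)
    have hd : Differentiable ℝ w := hw.differentiable (by simp)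
    let w' : C(E, E →L[ℝ] F) := ⟨fderiv ℝ w, hw1.continuous⟩
    have h' := ih w' hw1
    exact_mod_cast contDiff_succ_iff_hasFDerivAt.2
      ⟨fun β => pointwiseApply K E F (w'.comp β),
        (pointwiseApply K E F).contDiff.comp h', hasFDerivAt_postcomp w hd w' (fun _ => rfl)⟩

end Composition

/-! ### Regularity of flows -/

section Volterra

theorem continuous_comp_projIcc {E : Type*} [TopologicalSpace E] (β : C(Icc (-1 : ℝ) 1, E)) :
    Continuous fun r : ℝ => β (projIcc (-1) 1 (by norm_num) r) :=
  β.continuous.comp continuous_projIcc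

variable {E : Type*} [NormedAddCommGroup E] [NormedSpace ℝ E]

/-- Integration from `0`, as an operator on the continuous functions on `[-1, 1]`.  The interval has
`0` in its interior, so that integral curves with prescribed value at `0` are unique on it by the
two-sided statement; the integrand is extended by constants to all of `ℝ`. -/
noncomputable def volterra (E : Type*) [NormedAddCommGroup E] [NormedSpace ℝ E] :
    C(Icc (-1 : ℝ) 1, E) →L[ℝ] C(Icc (-1 : ℝ) 1, E) :=
  LinearMap.mkContinuous
    { toFun := fun β =>
        ⟨fun s => ∫ r in (0 : ℝ)..s, β (projIcc (-1) 1 (by norm_num) r),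
          (intervalIntegral.continuous_primitive
            (fun _ _ => (continuous_comp_projIcc β).intervalIntegrable _ _) 0).comp
            continuous_subtype_val⟩
      map_add' := fun β β' => by
        ext s
        exact intervalIntegral.integral_add ((continuous_comp_projIcc β).intervalIntegrable _ _)
          ((continuous_comp_projIcc β').intervalIntegrable _ _)
      map_smul' := fun c β => by
        ext s
        exact intervalIntegral.integral_smul c _ } 1
    (fun β => by
      rw [one_mul, ContinuousMap.norm_le _ (norm_nonneg _)]
      intro s
      refine (intervalIntegral.norm_integral_le_of_norm_le_const
        (fun r _ => β.norm_coe_le_norm _)).trans ?_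
      rw [sub_zero]
      exact mul_le_of_le_one_right (norm_nonneg _) (abs_le.2 s.2))

theorem volterra_apply (β : C(Icc (-1 : ℝ) 1, E)) (s : Icc (-1 : ℝ) 1) :
    volterra E β s = ∫ r in (0 : ℝ)..s, β (projIcc (-1) 1 (by norm_num) r) := rfl

end Volterra

section Flow

variable {d : ℕ}

theorem isGlobalSolution_flow {W : Space d → Space d} (hc : IsComplete W) (x : Space d) :
    IsGlobalSolution W x (fun t => flow W t x) := by
  have h : (fun t => flow W t x) = (hc x).choose := by
    funext t
    rw [flow, dif_pos (hc x)]
  rw [h]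
  exact (hc x).choose_spec

theorem flow_zero {W : Space d → Space d} (hc : IsComplete W) (x : Space d) : flow W 0 x = x :=
  (isGlobalSolution_flow hc x).1

theorem hasDerivAt_flow {W : Space d → Space d} (hc : IsComplete W) (x : Space d) (t : ℝ) :
    HasDerivAt (fun s => flow W s x) (W (flow W t x)) t :=
  (isGlobalSolution_flow hc x).2 t

theorem flow_eq_of_isGlobalSolution {W : Space d → Space d} (hW : ContDiff ℝ 1 W) {x : Space d}
    {γ : ℝ → Space d} (hγ : IsGlobalSolution W x γ) (t : ℝ) : flow W t x = γ t := by
  have hx : ∃ γ : ℝ → Space d, IsGlobalSolution W x γ := ⟨γ, hγ⟩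
  rw [flow, dif_pos hx]
  exact congrFun (eq_of_hasDerivAt hW hx.choose_spec.2 hγ.2
    (hx.choose_spec.1.trans hγ.1.symm)) t

theorem flow_add {W : Space d → Space d} (hW : ContDiff ℝ 1 W) (hc : IsComplete W) (s t : ℝ)
    (x : Space d) : flow W (s + t) x = flow W s (flow W t x) := by
  symm
  refine flow_eq_of_isGlobalSolution hW (γ := fun s => flow W (s + t) x) ⟨by simp, fun r => ?_⟩ s
  exact (hasDerivAt_flow hc x (r + t)).comp_add_const r t

/-- Solutions of `α(s) = x + τ ∫₀ˢ W(α)` on `[-1, 1]` are the rescaled integral curves of `W`. -/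
theorem flow_eq_of_integral_eq {W : Space d → Space d} (hW : ContDiff ℝ 1 W) (hc : IsComplete W)
    {τ : ℝ} {x : Space d} {α : C(Icc (-1 : ℝ) 1, Space d)}
    (hα : ∀ s, α s = x + τ •
      volterra (Space d) ((⟨W, hW.continuous⟩ : C(Space d, Space d)).comp α) s) :
    α ⟨1, by norm_num⟩ = flow W τ x := by
  set p : ℝ → Icc (-1 : ℝ) 1 := projIcc (-1) 1 (by norm_num)
  have hcont : Continuous fun r => W (α (p r)) :=
    hW.continuous.comp (continuous_comp_projIcc α)
  let a : ℝ → Space d := fun s => x + τ • ∫ r in (0 : ℝ)..s, W (α (p r))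
  have ha : ∀ s (hs : s ∈ Icc (-1 : ℝ) 1), α ⟨s, hs⟩ = a s := fun s hs => by
    rw [hα, volterra_apply]; rfl
  have ha' : ∀ s, HasDerivAt a (τ • W (α (p s))) s := fun s =>
    ((intervalIntegral.integral_hasDerivAt_right (hcont.intervalIntegrable _ _)
      hcont.stronglyMeasurable.stronglyMeasurableAtFilter hcont.continuousAt).const_smul τ).const_add x
  have hη : ∀ s, HasDerivAt (fun s => flow W (τ * s) x) (τ • W (flow W (τ * s) x)) s := fun s =>
    (hasDerivAt_flow hc x (τ * s)).scomp s (by simpa using (hasDerivAt_id s).const_mul τ)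
  have h := eqOn_Icc_of_hasDerivAt (W := fun y => τ • W y) (hW.const_smul τ)
    (γ := a) (η := fun s => flow W (τ * s) x) (a := -1) (b := 1) (t₀ := 0) (by norm_num)
    (fun s _ => (ha' s).continuousAt.continuousWithinAt)
    (fun s hs => by
      rw [← ha s (Ioo_subset_Icc_self hs), ← projIcc_of_mem (by norm_num) (Ioo_subset_Icc_self hs)]
      exact ha' s)
    (fun s _ => (hη s).continuousAt.continuousWithinAt) (fun s _ => hη s)
    (by simp [a, flow_zero hc]) (right_mem_Icc.2 (by norm_num))
  rw [ha 1, h]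
  simp only [mul_one]

/-- Near time `0` the flow is given by the implicit function theorem, applied in the Banach space
of continuous curves on `[-1, 1]` to the integral equation with the time scale as a parameter. -/
theorem contDiffAt_flow_zero {n : ℕ} (hn : n ≠ 0) {W : Space d → Space d} (hW : ContDiff ℝ n W)
    (hc : IsComplete W) (x₀ : Space d) :
    ContDiffAt ℝ n (fun p : ℝ × Space d => flow W p.1 p.2) (0, x₀) := by
  have hW1 : ContDiff ℝ 1 W := hW.of_le (by exact_mod_cast Nat.one_le_iff_ne_zero.2 hn)
  let B := C(Icc (-1 : ℝ) 1, Space d)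
  let w : C(Space d, Space d) := ⟨W, hW1.continuous⟩
  let c : Space d →L[ℝ] B := ContinuousLinearMap.const ℝ _
  let T : (ℝ × Space d) × B → B := fun q => q.2 - c q.1.2 - q.1.1 • volterra (Space d) (w.comp q.2)
  have hT : ContDiff ℝ n T := by
    have h1 : ContDiff ℝ n (fun q : (ℝ × Space d) × B => w.comp q.2) :=
      (contDiff_postcomp n w hW).comp contDiff_snd
    have h2 := (volterra (Space d)).contDiff.comp h1
    have h3 : ContDiff ℝ n (fun q : (ℝ × Space d) × B => c q.1.2) :=
      c.contDiff.comp (contDiff_snd.comp contDiff_fst)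
    exact (contDiff_snd.sub h3).sub ((contDiff_fst.comp contDiff_fst).smul h2)
  let u : (ℝ × Space d) × B := ((0, x₀), c x₀)
  have hTu : T u = 0 := by simp [T, u]
  have hn' : (n : WithTop ℕ∞) ≠ 0 := by exact_mod_cast hn
  have hinv : fderiv ℝ T u ∘L .inr ℝ (ℝ × Space d) B = ContinuousLinearMap.id ℝ B := by
    have h1 : HasFDerivAt T (fderiv ℝ T u) u := (hT.differentiable hn' u).hasFDerivAt
    have h2 := HasFDerivAt.comp (c x₀) h1 (hasFDerivAt_prodMk_right (0, x₀) (c x₀))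
    refine h2.unique (((hasFDerivAt_id (c x₀)).sub_const (c x₀)).congr_of_eventuallyEq ?_)
    exact Eventually.of_forall fun α => by simp [T]
  have hinv' : (fderiv ℝ T u ∘L .inr ℝ (ℝ × Space d) B).IsInvertible := by
    rw [hinv]; exact ContinuousLinearMap.isInvertible_equiv (f := ContinuousLinearEquiv.refl ℝ B)
  have hTat := hT.contDiffAt (x := u)
  let g := hTat.implicitFunction hn' hinv'
  have hg : ContDiffAt ℝ n g (0, x₀) := hTat.contDiffAt_implicitFunction hn' hinv'
  let ev : B →L[ℝ] Space d := ContinuousMap.evalCLM ℝ (⟨1, by norm_num⟩ : Icc (-1 : ℝ) 1)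
  refine (ev.contDiff.contDiffAt.comp _ hg).congr_of_eventuallyEq ?_
  filter_upwards [hTat.eventually_apply_implicitFunction hn' hinv'] with p hp
  refine (flow_eq_of_integral_eq hW1 hc (α := g p) fun s => ?_).symm
  have h0 : T (p, g p) = 0 := hp.trans hTu
  have h1 : g p = c p.2 + p.1 • volterra (Space d) (w.comp (g p)) := by
    rwa [← sub_eq_zero, ← sub_sub]
  exact DFunLike.congr_fun h1 s

/-- The flow of a complete `C^n` vector field is jointly `C^n` in time and space.  The points near
which it is `C^n` include a uniform neighbourhood of `{0} × K` for each compact piece `K` of an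
integral curve, and the group property carries the regularity along the curve. -/
theorem contDiff_flow {n : ℕ} (hn : n ≠ 0) {W : Space d → Space d} (hW : ContDiff ℝ n W)
    (hc : IsComplete W) : ContDiff ℝ n (fun p : ℝ × Space d => flow W p.1 p.2) := by
  have hW1 : ContDiff ℝ 1 W := hW.of_le (by exact_mod_cast Nat.one_le_iff_ne_zero.2 hn)
  rw [contDiff_iff_contDiffAt]
  rintro ⟨t, x⟩
  set Φ : ℝ × Space d → Space d := fun p => flow W p.1 p.2 with hΦ
  have hstep : ∀ s r, ContDiffAt ℝ n Φ (s, x) → ContDiffAt ℝ n Φ (r, flow W s x) →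
      ContDiffAt ℝ n Φ (r + s, x) := by
    intro s r h1 h2
    have h3 : ContDiffAt ℝ n (fun p : ℝ × Space d => Φ (s, p.2)) (r + s, x) :=
      ContDiffAt.comp (r + s, x) (g := Φ) (f := fun p : ℝ × Space d => (s, p.2)) h1
        (by fun_prop)
    have h4 : ContDiffAt ℝ n (fun p : ℝ × Space d => Φ (p.1 - s, Φ (s, p.2))) (r + s, x) :=
      ContDiffAt.comp (r + s, x) (g := Φ) (f := fun p : ℝ × Space d => (p.1 - s, Φ (s, p.2)))
        (by simpa [hΦ] using h2) ((contDiffAt_fst.sub contDiffAt_const).prodMk h3)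
    refine h4.congr_of_eventuallyEq (Eventually.of_forall fun p => ?_)
    simp only [hΦ]
    rw [← flow_add hW1 hc, sub_add_cancel]
  let S : Set (ℝ × Space d) := {p | ContDiffAt ℝ n Φ p}
  have hS : IsOpen S := by
    rw [isOpen_iff_mem_nhds]
    exact fun p hp => ContDiffAt.eventually hp (by simp)
  have hcurve : Continuous fun s => flow W s x :=
    continuous_iff_continuousAt.2 fun s => (hasDerivAt_flow hc x s).continuousAt
  have hK : IsCompact ((fun s => flow W s x) '' Icc (-|t|) |t|) := isCompact_Icc.image hcurve
  obtain ⟨A, B, hA, -, h0A, hKB, hAB⟩ := generalized_tube_lemma (isCompact_singleton (x := (0 : ℝ)))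
    hK hS (by
      rintro ⟨r, y⟩ ⟨hr, -⟩
      obtain rfl : r = 0 := hr
      exact contDiffAt_flow_zero hn hW hc y)
  obtain ⟨δ, hδ, hδA⟩ := Metric.isOpen_iff.1 hA 0 (h0A rfl)
  obtain ⟨N, hN⟩ := exists_nat_gt (|t| / δ)
  have hN0 : (0 : ℝ) < N := (div_nonneg (abs_nonneg t) hδ.le).trans_lt hN
  have hmain : ∀ k : ℕ, k ≤ N → ContDiffAt ℝ n Φ (k * (t / N), x) := by
    intro k
    induction k with
    | zero => intro _; simpa using contDiffAt_flow_zero hn hW hc x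
    | succ k ih =>
      intro hk
      have hk' : (k : ℝ) ≤ N := by exact_mod_cast (Nat.le_succ k).trans hk
      have := hstep (k * (t / N)) (t / N) (ih ((Nat.le_succ k).trans hk))
        (hAB ⟨hδA ?_, hKB ⟨_, ?_, rfl⟩⟩)
      · convert! this using 2
        push_cast; ring
      · rw [mem_ball_zero_iff, Real.norm_eq_abs, abs_div, Nat.abs_cast, div_lt_iff₀ hN0]
        rwa [div_lt_iff₀ hδ, mul_comm] at hN
      · rw [mem_Icc, ← abs_le, abs_mul, Nat.abs_cast, abs_div, Nat.abs_cast, ← mul_div_assoc,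
          div_le_iff₀ hN0, mul_comm]
        gcongr
  have := hmain N le_rfl
  rwa [mul_div_cancel₀ _ hN0.ne'] at this

end Flow

/-! ### Orbits -/

section Orbit

variable {d n : ℕ} {V : Fin n → Space d → Space d}

theorem foldl_flow_single (hc : ∀ k, IsComplete (V k)) (k : Fin n) (s : ℝ) (l : List (Fin n)) :
    l.Nodup → ∀ x, l.foldl (fun y j => flow (V j) ((Pi.single k s : Fin n → ℝ) j) y) x =
      if k ∈ l then flow (V k) s x else x := by
  induction l with
  | nil => simp
  | cons j l ih =>
    intro hl x
    rw [List.nodup_cons] at hl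
    rw [List.foldl_cons, ih hl.2]
    by_cases hjk : j = k
    · subst hjk
      simp [hl.1]
    · simp [flow_zero (hc j), Ne.symm hjk]

theorem cycle_single (hc : ∀ k, IsComplete (V k)) (k : Fin n) (s : ℝ) (x : Space d) :
    cycle V (Pi.single k s) x = flow (V k) s x := by
  rw [cycle, foldl_flow_single hc k s _ (List.nodup_finRange n), if_pos (List.mem_finRange k)]

theorem cycle_zero (hc : ∀ k, IsComplete (V k)) (x : Space d) : cycle V 0 x = x := by
  suffices h : ∀ l : List (Fin n), l.foldl (fun y j => flow (V j) ((0 : Fin n → ℝ) j) y) x = x from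
    h _
  intro l
  induction l with
  | nil => rfl
  | cons j l ih => simpa [flow_zero (hc j)] using ih

theorem mem_orbit_self (x : Space d) : x ∈ orbit V x := ⟨[], rfl⟩

theorem cycle_mem_orbit {x y : Space d} (hy : y ∈ orbit V x) (t : Fin n → ℝ) :
    cycle V t y ∈ orbit V x := by
  obtain ⟨ts, rfl⟩ := hy
  exact ⟨ts ++ [t], by simp⟩

theorem flow_mem_orbit (hc : ∀ k, IsComplete (V k)) {x y : Space d} (hy : y ∈ orbit V x)
    (k : Fin n) (s : ℝ) : flow (V k) s y ∈ orbit V x := by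
  rw [← cycle_single hc]
  exact cycle_mem_orbit hy _

theorem orbit_induction {x : Space d} {P : Space d → Prop} (h0 : P x)
    (hstep : ∀ y k s, P y → P (flow (V k) s y)) : ∀ y ∈ orbit V x, P y := by
  have hcycle : ∀ (t : Fin n → ℝ) (l : List (Fin n)) y, P y →
      P (l.foldl (fun y k => flow (V k) (t k) y) y) := by
    intro t l
    induction l with
    | nil => exact fun y hy => hy
    | cons k l ih => exact fun y hy => ih _ (hstep y k _ hy)
  have hlist : ∀ (ts : List (Fin n → ℝ)) y, P y → P (ts.foldl (fun z t => cycle V t z) y) := by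
    intro ts
    induction ts with
    | nil => exact fun y hy => hy
    | cons t ts ih => exact fun y hy => ih _ (hcycle t _ y hy)
  rintro y ⟨ts, rfl⟩
  exact hlist ts x h0

theorem orbit_subset_of_mem {x y : Space d} (hy : y ∈ orbit V x) : orbit V y ⊆ orbit V x := by
  obtain ⟨ts, rfl⟩ := hy
  rintro z ⟨ts', rfl⟩
  exact ⟨ts ++ ts', by simp⟩

theorem orbit_eq_of_mem (hC : ∀ k, ContDiff ℝ 1 (V k)) (hc : ∀ k, IsComplete (V k))
    {x y : Space d} (hy : y ∈ orbit V x) : orbit V y = orbit V x := by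
  refine (orbit_subset_of_mem hy).antisymm (orbit_subset_of_mem ?_)
  refine orbit_induction (P := fun y => x ∈ orbit V y) (mem_orbit_self x) ?_ y hy
  intro y k s hx
  have hback : y ∈ orbit V (flow (V k) s y) := by
    have h := flow_mem_orbit hc (mem_orbit_self (V := V) (flow (V k) s y)) k (-s)
    rwa [← flow_add (hC k) (hc k), neg_add_cancel, flow_zero (hc k)] at h
  exact orbit_subset_of_mem hback hx

theorem contDiff_cycle (hC2 : ∀ k, ContDiff ℝ 2 (V k)) (hc : ∀ k, IsComplete (V k)) :
    ContDiff ℝ 2 (fun p : (Fin n → ℝ) × Space d => cycle V p.1 p.2) := by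
  suffices h : ∀ (l : List (Fin n)) (g : (Fin n → ℝ) × Space d → Space d), ContDiff ℝ 2 g →
      ContDiff ℝ 2 (fun p => l.foldl (fun y k => flow (V k) (p.1 k) y) (g p)) from
    h _ _ contDiff_snd
  intro l
  induction l with
  | nil => exact fun g hg => hg
  | cons k l ih =>
    intro g hg
    refine ih _ ?_
    exact (contDiff_flow two_ne_zero (hC2 k) (hc k)).comp
      (((contDiff_apply ℝ ℝ k).comp contDiff_fst).prodMk hg)

end Orbit

/-! ### The sum of the fields is tangent to the orbits -/

section Tangency

variable {d n : ℕ} {V : Fin n → Space d → Space d}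

theorem fderiv_flow_zero {W : Space d → Space d} (hW : ContDiff ℝ 2 W) (hc : IsComplete W)
    (y : Space d) (s : ℝ) (v : Space d) :
    fderiv ℝ (fun p : ℝ × Space d => flow W p.1 p.2) (0, y) (s, v) = s • W y + v := by
  have hd := (((contDiff_flow two_ne_zero hW hc).differentiable two_ne_zero) (0, y)).hasFDerivAt
  set D := fderiv ℝ (fun p : ℝ × Space d => flow W p.1 p.2) (0, y)
  have h1 : D (1, 0) = W y := by
    have h2 : HasDerivAt (fun r : ℝ => flow W r y) (D (1, 0)) 0 :=
      hd.comp_hasDerivAt (0 : ℝ) (f := fun r : ℝ => (r, y))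
        ((hasDerivAt_id (0 : ℝ)).prodMk (hasDerivAt_const _ y))
    simpa [flow_zero hc] using h2.unique (hasDerivAt_flow hc y 0)
  have h3 : D ∘L .inr ℝ ℝ (Space d) = .id ℝ _ := by
    have h4 := hd.comp y (hasFDerivAt_prodMk_right (𝕜 := ℝ) (0 : ℝ) y)
    refine h4.unique ((hasFDerivAt_id y).congr_of_eventuallyEq (Eventually.of_forall fun x => ?_))
    exact flow_zero hc x
  have h5 : D (0, v) = v := DFunLike.congr_fun h3 v
  have h6 : ((s, v) : ℝ × Space d) = s • (1, 0) + (0, v) := by simp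
  rw [h6, map_add, map_smul, h1, h5]

theorem injective_fderiv_flow {W : Space d → Space d} (hW : ContDiff ℝ 2 W) (hc : IsComplete W)
    (s : ℝ) (y : Space d) : Function.Injective (fderiv ℝ (fun x => flow W s x) y) := by
  have hdiff : ∀ r, Differentiable ℝ (fun x => flow W r x) := fun r =>
    ((contDiff_flow two_ne_zero hW hc).comp (contDiff_const.prodMk contDiff_id)).differentiable
      two_ne_zero
  have h1 := (hdiff (-s) (flow W s y)).hasFDerivAt.comp y (hdiff s y).hasFDerivAt
  have h2 := h1.unique ((hasFDerivAt_id y).congr_of_eventuallyEq (Eventually.of_forall fun x => by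
    simp only [Function.comp_apply, id]
    rw [← flow_add (hW.of_le one_le_two) hc, neg_add_cancel, flow_zero hc]))
  exact Function.LeftInverse.injective (g := fderiv ℝ (fun x => flow W (-s) x) (flow W s y))
    fun v => DFunLike.congr_fun h2 v

/-- There is a largest dimension `r` of a `C^2` map into the orbit that is an immersion at `0`, and
such a map exists through every point of the orbit: the flows move it around. -/
theorem exists_maximal_immersion (hC2 : ∀ k, ContDiff ℝ 2 (V k)) (hc : ∀ k, IsComplete (V k))
    (x : Space d) :
    ∃ r : ℕ, (∀ y ∈ orbit V x, ∃ F : (Fin r → ℝ) → Space d, IsC2MapInto (orbit V x) F ∧ F 0 = y ∧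
        Function.Injective (fderiv ℝ F 0)) ∧
      ∀ F : (Fin (r + 1) → ℝ) → Space d, IsC2MapInto (orbit V x) F →
        ¬ Function.Injective (fderiv ℝ F 0) := by
  classical
  let I : ℕ → Prop := fun p => ∃ F : (Fin p → ℝ) → Space d, IsC2MapInto (orbit V x) F ∧
    Function.Injective (fderiv ℝ F 0)
  have hI0 : I 0 := ⟨fun _ => x, ⟨contDiff_const, fun _ => mem_orbit_self x⟩,
    Function.injective_of_subsingleton _⟩
  have hId : ∀ p, I p → p ≤ d := by
    rintro p ⟨F, -, hF⟩
    simpa using LinearMap.finrank_le_finrank_of_injective (f := (fderiv ℝ F 0).toLinearMap) hF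
  refine ⟨Nat.findGreatest I d, ?_, fun F hF hinj => ?_⟩
  · obtain ⟨F, hF, hinj⟩ : I (Nat.findGreatest I d) := Nat.findGreatest_spec (Nat.zero_le d) hI0
    have horb : orbit V (F 0) = orbit V x :=
      orbit_eq_of_mem (fun k => (hC2 k).of_le one_le_two) hc (hF.2 0)
    rw [← horb] at hF ⊢
    refine orbit_induction ⟨F, hF, rfl, hinj⟩ ?_
    rintro y k s ⟨G, hG, rfl, hGinj⟩
    have hflow : ContDiff ℝ 2 (fun x => flow (V k) s x) :=
      (contDiff_flow two_ne_zero (hC2 k) (hc k)).comp (contDiff_const.prodMk contDiff_id)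
    refine ⟨fun u => flow (V k) s (G u), ⟨hflow.comp hG.1, fun u => flow_mem_orbit hc (hG.2 u) k s⟩,
      rfl, ?_⟩
    have h1 := (hflow.differentiable two_ne_zero (G 0)).hasFDerivAt.comp 0
      (hG.1.differentiable two_ne_zero 0).hasFDerivAt
    have h2 : fderiv ℝ (fun u => flow (V k) s (G u)) 0 = _ := h1.fderiv
    rw [h2]
    exact (injective_fderiv_flow (hC2 k) (hc k) s (G 0)).comp hGinj
  · have hle := Nat.le_findGreatest (P := I) (hId _ ⟨F, hF, hinj⟩) ⟨F, hF, hinj⟩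
    omega

/-- Otherwise the flow of `V k` through the image of `F` would give an immersion of one dimension
more. -/
theorem mem_range_fderiv_of_maximal (hC2 : ∀ k, ContDiff ℝ 2 (V k)) (hc : ∀ k, IsComplete (V k))
    {x : Space d} {r : ℕ}
    (hmax : ∀ F : (Fin (r + 1) → ℝ) → Space d, IsC2MapInto (orbit V x) F →
      ¬ Function.Injective (fderiv ℝ F 0))
    {F : (Fin r → ℝ) → Space d} (hF : IsC2MapInto (orbit V x) F) {u : Fin r → ℝ}
    (hu : Function.Injective (fderiv ℝ F u)) (k : Fin n) :
    V k (F u) ∈ LinearMap.range (fderiv ℝ F u).toLinearMap := by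
  by_contra hk
  let T : (Fin (r + 1) → ℝ) →L[ℝ] (Fin r → ℝ) :=
    ContinuousLinearMap.pi fun i => ContinuousLinearMap.proj i.succ
  let G : (Fin (r + 1) → ℝ) → Space d := fun w => flow (V k) (w 0) (F (u + T w))
  have hflow := contDiff_flow two_ne_zero (hC2 k) (hc k)
  have hG : IsC2MapInto (orbit V x) G :=
    ⟨hflow.comp ((contDiff_apply ℝ ℝ 0).prodMk (hF.1.comp (contDiff_const.add T.contDiff))),
      fun w => flow_mem_orbit hc (hF.2 _) k _⟩
  refine hmax G hG ?_
  have hFu : HasFDerivAt F (fderiv ℝ F u) (u + T 0) := by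
    rw [map_zero, add_zero]
    exact (hF.1.differentiable two_ne_zero u).hasFDerivAt
  have h1 : HasFDerivAt (fun w => F (u + T w)) (fderiv ℝ F u ∘L T) 0 :=
    hFu.comp 0 (T.hasFDerivAt.const_add u)
  have h2 : HasFDerivAt (fun w : Fin (r + 1) → ℝ => (w 0, F (u + T w)))
      ((ContinuousLinearMap.proj 0 : (Fin (r + 1) → ℝ) →L[ℝ] ℝ).prod (fderiv ℝ F u ∘L T)) 0 :=
    (ContinuousLinearMap.proj 0 : (Fin (r + 1) → ℝ) →L[ℝ] ℝ).hasFDerivAt.prodMk h1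
  have h3 : HasFDerivAt (fun p : ℝ × Space d => flow (V k) p.1 p.2)
      (fderiv ℝ (fun p : ℝ × Space d => flow (V k) p.1 p.2) (0, F u))
      ((0 : Fin (r + 1) → ℝ) 0, F (u + T 0)) := by
    rw [map_zero, add_zero]
    exact (hflow.differentiable two_ne_zero (0, F u)).hasFDerivAt
  have h4 := (HasFDerivAt.comp (f := fun w : Fin (r + 1) → ℝ => (w 0, F (u + T w))) 0 h3 h2).fderiv
  have h5 : ∀ w, fderiv ℝ G 0 w = w 0 • V k (F u) + fderiv ℝ F u (T w) := by
    intro w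
    rw [← fderiv_flow_zero (hC2 k) (hc k)]
    exact DFunLike.congr_fun h4 w
  rw [injective_iff_map_eq_zero]
  intro w hw
  rw [h5] at hw
  have hw0 : w 0 = 0 := by
    by_contra hne
    refine hk ⟨-(w 0)⁻¹ • T w, ?_⟩
    rw [ContinuousLinearMap.coe_coe, map_smul, eq_neg_of_add_eq_zero_right hw,
      smul_neg, neg_smul, neg_neg, smul_smul, inv_mul_cancel₀ hne, one_smul]
  rw [hw0, zero_smul, zero_add] at hw
  have hTw : T w = 0 := hu (hw.trans (map_zero _).symm)
  funext i
  refine Fin.cases hw0 (fun i => ?_) i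
  exact congrFun hTw i

/-- Every point has a piece of integral curve of the sum of the fields that runs in the orbit.  In
the coordinates of an immersion `F` of maximal dimension, whose derivatives span all `V k` near `0`,
it solves the equation `DF(u) u' = V(F(u))`, which a left inverse of `DF(0)` puts into the form
`u' = a(u)` with `a` of class `C^1`. -/
theorem exists_local_solution_mem_orbit (hC2 : ∀ k, ContDiff ℝ 2 (V k))
    (hc : ∀ k, IsComplete (V k)) (y : Space d) :
    ∃ γ : ℝ → Space d, γ 0 = y ∧ ∃ ε > 0, ∀ s ∈ Ioo (-ε) ε,
      γ s ∈ orbit V y ∧ HasDerivAt γ (totalField V (γ s)) s := by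
  obtain ⟨r, himm, hmax⟩ := exists_maximal_immersion hC2 hc y
  obtain ⟨F, hF, hF0, hinj⟩ := himm y (mem_orbit_self y)
  obtain ⟨B, hB⟩ : ∃ B : Space d →L[ℝ] (Fin r → ℝ), B ∘L fderiv ℝ F 0 = .id ℝ _ := by
    obtain ⟨B, hB⟩ := LinearMap.exists_leftInverse_of_injective (fderiv ℝ F 0).toLinearMap
      (LinearMap.ker_eq_bot.2 hinj)
    refine ⟨LinearMap.toContinuousLinearMap B, ?_⟩
    ext1 v
    exact LinearMap.congr_fun hB v
  have hDF : ContDiff ℝ 1 (fderiv ℝ F) := hF.1.fderiv_right (by norm_num)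
  let M : (Fin r → ℝ) → (Fin r → ℝ) →L[ℝ] (Fin r → ℝ) := fun u => B ∘L fderiv ℝ F u
  have hM : ContDiff ℝ 1 M := contDiff_const.clm_comp hDF
  have hM0 : M 0 = ((1 : ((Fin r → ℝ) →L[ℝ] (Fin r → ℝ))ˣ) : (Fin r → ℝ) →L[ℝ] (Fin r → ℝ)) := hB
  have hV : ContDiff ℝ 1 (totalField V) := ContDiff.sum fun k _ => (hC2 k).of_le one_le_two
  let a : (Fin r → ℝ) → (Fin r → ℝ) := fun u => Ring.inverse (M u) (B (totalField V (F u)))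
  have ha : ContDiffAt ℝ 1 a 0 := by
    have h1 : ContDiffAt ℝ 1 (fun u => Ring.inverse (M u)) 0 := by
      refine ContDiffAt.comp 0 (g := Ring.inverse) ?_ hM.contDiffAt
      rw [hM0]
      exact contDiffAt_ringInverse ℝ 1
    exact h1.clm_apply
      (B.contDiff.comp (hV.comp (hF.1.of_le one_le_two))).contDiffAt
  have hgood : ∀ᶠ u in 𝓝 (0 : Fin r → ℝ), fderiv ℝ F u (a u) = totalField V (F u) := by
    have hunit : ∀ᶠ u in 𝓝 (0 : Fin r → ℝ), IsUnit (M u) :=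
      hM.continuous.continuousAt.eventually_mem
        (Units.isOpen.mem_nhds (by rw [hM0]; exact Units.isUnit _))
    filter_upwards [hunit] with u hu
    have hMinv : ∀ v, Ring.inverse (M u) (M u v) = v := fun v =>
      DFunLike.congr_fun (Ring.inverse_mul_cancel _ hu) v
    have hDinj : Function.Injective (fderiv ℝ F u) := fun v w hvw => by
      rw [← hMinv v, ← hMinv w]
      exact congrArg (fun z => Ring.inverse (M u) (B z)) hvw
    obtain ⟨w, hw⟩ : totalField V (F u) ∈ LinearMap.range (fderiv ℝ F u).toLinearMap :=
      Submodule.sum_mem _ fun k _ => mem_range_fderiv_of_maximal hC2 hc hmax hF hDinj k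
    simp only [a, ← hw]
    exact congrArg (fderiv ℝ F u) (hMinv w)
  obtain ⟨β, hβ0, ε, hε, hβ⟩ :=
    ha.exists_forall_mem_closedBall_exists_eq_forall_mem_Ioo_hasDerivAt₀ 0
  rw [zero_sub, zero_add] at hβ
  have hβc : ContinuousAt β 0 := (hβ 0 ⟨neg_lt_zero.2 hε, hε⟩).continuousAt
  have hev : ∀ᶠ s in 𝓝 (0 : ℝ), fderiv ℝ F (β s) (a (β s)) = totalField V (F (β s)) :=
    hβc.eventually (hβ0.symm ▸ hgood)
  obtain ⟨δ, hδ, hball⟩ := Metric.eventually_nhds_iff_ball.1 hev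
  refine ⟨fun s => F (β s), by simp [hβ0, hF0], min ε δ, lt_min hε hδ, fun s hs => ⟨hF.2 _, ?_⟩⟩
  have hsε : s ∈ Ioo (-ε) ε :=
    ⟨(neg_le_neg (min_le_left _ _)).trans_lt hs.1, hs.2.trans_le (min_le_left _ _)⟩
  have hsδ : s ∈ Metric.ball (0 : ℝ) δ := by
    rw [mem_ball_zero_iff, Real.norm_eq_abs]
    exact (abs_lt.2 hs).trans_le (min_le_right _ _)
  rw [← hball s hsδ]
  exact (hF.1.differentiable two_ne_zero (β s)).hasFDerivAt.comp_hasDerivAt s (hβ s hsε)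

end Tangency

/-! ### The true dynamics stays in the orbits -/

section Invariance

variable {d n : ℕ} {V : Fin n → Space d → Space d}

theorem isComplete_of_hasCompactSupport {W : Space d → Space d} (hW : ContDiff ℝ 1 W)
    (hs : HasCompactSupport W) : IsComplete W := by
  intro x
  obtain ⟨L, hL⟩ := hs.exists_bound_of_continuous hW.continuous
  obtain ⟨K, hK⟩ := hW.lipschitzWith_of_hasCompactSupport hs one_ne_zero
  have hL0 : 0 ≤ L := (norm_nonneg _).trans (hL x)
  have hex : ∀ T : ℝ, 0 < T → ∃ γ : ℝ → Space d, γ 0 = x ∧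
      ∀ s ∈ Ioo (-T) T, HasDerivAt γ (W (γ s)) s := by
    intro T hT
    have hPL : IsPicardLindelof (fun _ => W) (tmin := -T) (tmax := T)
        ⟨0, by simp [hT.le]⟩ x (L.toNNReal * T.toNNReal) 0 L.toNNReal K := by
      refine IsPicardLindelof.of_time_independent (fun y _ => ?_) hK.lipschitzOnWith ?_
      · rw [Real.coe_toNNReal L hL0]
        exact hL y
      · simp [Real.coe_toNNReal T hT.le]
    obtain ⟨γ, hγ0, hγ⟩ := hPL.exists_eq_forall_mem_Icc_hasDerivWithinAt₀
    exact ⟨γ, hγ0, fun s hs =>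
      (hγ s (Ioo_subset_Icc_self hs)).hasDerivAt (Icc_mem_nhds hs.1 hs.2)⟩
  -- The solutions on `(-T, T)` agree where they overlap, so that `s ↦ γ (|s| + 1) s` glues them.
  choose! γ hγ0 hγ using hex
  have hagree : ∀ S T, 0 < S → S ≤ T → EqOn (γ S) (γ T) (Ioo (-S) S) := fun S T hS hST =>
    eqOn_Ioo_of_hasDerivAt hW (t₀ := 0) ⟨neg_lt_zero.2 hS, hS⟩ (hγ S hS)
      (fun s hs => hγ T (hS.trans_le hST) s
        ⟨(neg_le_neg hST).trans_lt hs.1, hs.2.trans_le hST⟩)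
      ((hγ0 S hS).trans (hγ0 T (hS.trans_le hST)).symm)
  have hmem : ∀ s : ℝ, s ∈ Ioo (-(|s| + 1)) (|s| + 1) := fun s => by
    constructor <;> linarith [neg_abs_le s, le_abs_self s]
  refine ⟨fun s => γ (|s| + 1) s, hγ0 _ (by positivity), fun s => ?_⟩
  have hs1 : γ (|s| + 1) s = γ (|s| + 2) s :=
    hagree _ _ (by positivity) (by linarith) (hmem s)
  beta_reduce
  rw [hs1]
  refine (hγ (|s| + 2) (by positivity) s ?_).congr_of_eventuallyEq ?_
  · constructor <;> linarith [neg_abs_le s, le_abs_self s]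
  · filter_upwards [continuous_abs.continuousAt.eventually_lt continuousAt_const
      (lt_add_one |s|)] with r hr
    exact hagree _ _ (by positivity) (by linarith) (hmem r)

/-- On a bounded orbit the true dynamics is the flow of a complete `C^2` field on `ℝ^d`, namely of
the sum of the fields cut off away from the orbit, and it leaves the orbit invariant: by
`exists_local_solution_mem_orbit` the times at which an integral curve is in a given orbit form an
open and closed set. -/
theorem exists_complete_field (hC2 : ∀ k, ContDiff ℝ 2 (V k)) (hc : ∀ k, IsComplete (V k))
    {x₀ : Space d} (hb : Bornology.IsBounded (orbit V x₀)) :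
    ∃ W : Space d → Space d, ContDiff ℝ 2 W ∧ IsComplete W ∧
      (∀ x ∈ orbit V x₀, W x = totalField V x) ∧
      (∀ x ∈ orbit V x₀, ∀ t, flow W t x ∈ orbit V x₀) ∧
      ∀ x ∈ orbit V x₀, ∀ t, flow (totalField V) t x = flow W t x := by
  have hV : ContDiff ℝ 2 (totalField V) := ContDiff.sum fun k _ => hC2 k
  obtain ⟨R, hR⟩ := hb.subset_closedBall 0
  let χ : ContDiffBump (0 : Space d) := ⟨|R| + 1, |R| + 2, by positivity, by linarith⟩
  let W : Space d → Space d := fun x => χ x • totalField V x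
  have hW : ContDiff ℝ 2 W := χ.contDiff.smul hV
  have hW1 : ContDiff ℝ 1 W := hW.of_le one_le_two
  have hWc : IsComplete W := isComplete_of_hasCompactSupport hW1 χ.hasCompactSupport.smul_right
  have hWV : ∀ x ∈ Metric.ball (0 : Space d) (|R| + 1), W x = totalField V x := fun x hx => by
    simp only [W]
    rw [χ.one_of_mem_closedBall (Metric.ball_subset_closedBall hx), one_smul]
  have hball : Metric.closedBall (0 : Space d) R ⊆ Metric.ball 0 (|R| + 1) :=
    Metric.closedBall_subset_ball ((le_abs_self R).trans_lt (lt_add_one _))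
  have hlocal : ∀ y ∈ Metric.ball (0 : Space d) (|R| + 1),
      ∀ᶠ s in 𝓝 (0 : ℝ), flow W s y ∈ orbit V y := by
    intro y hy
    obtain ⟨γ, hγ0, ε, hε, hγ⟩ := exists_local_solution_mem_orbit hC2 hc y
    have hγc : ContinuousAt γ 0 := (hγ 0 ⟨neg_lt_zero.2 hε, hε⟩).2.continuousAt
    have hev : ∀ᶠ s in 𝓝 (0 : ℝ), s ∈ Ioo (-ε) ε ∧ γ s ∈ Metric.ball (0 : Space d) (|R| + 1) :=
      Filter.Eventually.and (Ioo_mem_nhds (neg_lt_zero.2 hε) hε)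
        (hγc.eventually_mem (Metric.isOpen_ball.mem_nhds (hγ0.symm ▸ hy)))
    obtain ⟨δ, hδ, hδball⟩ := Metric.eventually_nhds_iff_ball.1 hev
    rw [Real.ball_eq_Ioo, zero_sub, zero_add] at hδball
    filter_upwards [Ioo_mem_nhds (neg_lt_zero.2 hδ) hδ] with s hs
    have heq : EqOn (fun s => flow W s y) γ (Ioo (-δ) δ) :=
      eqOn_Ioo_of_hasDerivAt hW1 (t₀ := 0) ⟨neg_lt_zero.2 hδ, hδ⟩
        (fun r _ => hasDerivAt_flow hWc y r)
        (fun r hr => by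
          rw [hWV _ (hδball r hr).2]
          exact (hγ r (hδball r hr).1).2)
        (by simp [flow_zero hWc, hγ0])
    have h := heq hs
    simp only at h
    rw [h]
    exact (hγ s (hδball s hs).1).1
  have hlocal' : ∀ x s, flow W s x ∈ Metric.ball (0 : Space d) (|R| + 1) →
      ∀ᶠ s' in 𝓝 s, flow W s' x ∈ orbit V (flow W s x) := by
    intro x s hs
    have h0 : Tendsto (fun s' => s' - s) (𝓝 s) (𝓝 0) := by
      simpa using (continuous_id.sub continuous_const).tendsto (f := fun s' : ℝ => s' - s) s
    filter_upwards [h0.eventually (hlocal _ hs)] with s' hs'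
    rwa [← flow_add hW1 hWc, sub_add_cancel] at hs'
  have horb : ∀ {x y}, y ∈ orbit V x → orbit V y = orbit V x :=
    orbit_eq_of_mem (fun k => (hC2 k).of_le one_le_two) hc
  have hinv : ∀ x ∈ orbit V x₀, ∀ t, flow W t x ∈ orbit V x₀ := by
    intro x hx
    let S : Set ℝ := {s | flow W s x ∈ orbit V x₀}
    have hcurve : Continuous fun s => flow W s x :=
      continuous_iff_continuousAt.2 fun s => (hasDerivAt_flow hWc x s).continuousAt
    have hopen : IsOpen S := by
      rw [isOpen_iff_mem_nhds]
      intro s hs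
      filter_upwards [hlocal' x s (hball (hR hs))] with s' hs'
      exact (horb hs).subset hs'
    -- At a limit point `s` of `S` the curve near `s` runs in the orbit of `flow W s x`, and also
    -- meets the given orbit; so the two orbits coincide.
    have hclosed : IsClosed S := by
      refine isClosed_of_closure_subset fun s hs => ?_
      have hsR : flow W s x ∈ Metric.closedBall (0 : Space d) R :=
        
        closure_minimal (t := (fun s => flow W s x) ⁻¹' Metric.closedBall 0 R)
          (fun r hr => hR hr) (Metric.isClosed_closedBall.preimage hcurve) hs
      obtain ⟨s', hs'S, hs'⟩ :=
        ((mem_closure_iff_frequently.1 hs).and_eventually (hlocal' x s (hball hsR))).exists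
      have h : orbit V (flow W s x) = orbit V x₀ := (horb hs').symm.trans (horb hs'S)
      exact h.subset (mem_orbit_self _)
    have huniv : S = univ := IsClopen.eq_univ ⟨hclosed, hopen⟩
      ⟨0, by simpa [S, flow_zero hWc] using hx⟩
    exact fun t => (huniv.symm.subset (mem_univ t) : t ∈ S)
  have hWV' : ∀ x ∈ orbit V x₀, W x = totalField V x := fun x hx => hWV x (hball (hR hx))
  refine ⟨W, hW, hWc, hWV', hinv, fun x hx t => ?_⟩
  refine flow_eq_of_isGlobalSolution (hV.of_le one_le_two) (γ := fun s => flow W s x)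
    ⟨flow_zero hWc x, fun s => ?_⟩ t
  rw [← hWV' _ (hinv x hx s)]
  exact hasDerivAt_flow hWc x s

end Invariance

/-! ### Derivatives of functions on a set along maps into it -/

section Calculus

variable {E : Type*} [NormedAddCommGroup E] [InnerProductSpace ℝ E] [FiniteDimensional ℝ E]
  {X : Set E} {f : E → ℝ} {x : E}

/-- The chain rule along curves determines the first derivative on the velocities, which span the
tangent space. -/
theorem IsFirstDerivAt.unique {L L' : tangentSpace X x →L[ℝ] ℝ} (hL : IsFirstDerivAt X f x L)
    (hL' : IsFirstDerivAt X f x L') : L = L' := by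
  have hgen : EqOn (L ∘L tangentProj X x) (L' ∘L tangentProj X x)
      (tangentSpace X x : Set E) := by
    refine LinearMap.eqOn_span (f := (L ∘L tangentProj X x).toLinearMap)
      (g := (L' ∘L tangentProj X x).toLinearMap) ?_
    rintro _ ⟨γ, hγ, hγX, hγ0, rfl⟩
    let P : (Fin 1 → ℝ) →L[ℝ] ℝ := ContinuousLinearMap.proj 0
    have hF : IsC2MapInto X (fun u : Fin 1 → ℝ => γ (P u)) :=
      ⟨hγ.comp P.contDiff, fun u => hγX _⟩
    have hderiv : fderiv ℝ (fun u : Fin 1 → ℝ => γ (P u)) 0 (fun _ => 1) = deriv γ 0 := by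
      have h1 : HasDerivAt γ (deriv γ 0) (P 0) := by
        rw [map_zero]
        exact (hγ.differentiable two_ne_zero 0).hasDerivAt
      have h2 := (h1.hasFDerivAt.comp (0 : Fin 1 → ℝ) P.hasFDerivAt).fderiv
      rw [show (fun u : Fin 1 → ℝ => γ (P u)) = γ ∘ P from rfl, h2]
      simp [P]
    have h1 := hL 1 _ hF (by simpa using hγ0) (fun _ => 1)
    have h2 := hL' 1 _ hF (by simpa using hγ0) (fun _ => 1)
    rw [hderiv] at h1 h2
    exact h1.symm.trans h2
  ext1 v
  have h := hgen v.2
  have hv : tangentProj X x v = v := Submodule.orthogonalProjectionOnto_mem_subspace_eq_self v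
  simpa [hv] using h

theorem isFirstDerivAt_firstDeriv (hf : IsC2On X f) (hx : x ∈ X) :
    IsFirstDerivAt X f x (firstDeriv X f x) := by
  obtain ⟨L, hL, -⟩ := hf.2 x hx
  have h : ∃ L, IsFirstDerivAt X f x L := ⟨L, hL⟩
  rw [firstDeriv, dif_pos h]
  exact h.choose_spec

theorem isSecondDerivAt_secondDeriv (hf : IsC2On X f) (hx : x ∈ X) :
    IsSecondDerivAt X f x (firstDeriv X f x) (secondDeriv X f x) := by
  obtain ⟨L, hL, Q, hQ⟩ := hf.2 x hx
  rw [hL.unique (isFirstDerivAt_firstDeriv hf hx)] at hQ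
  have h : ∃ Q, IsSecondDerivAt X f x (firstDeriv X f x) Q := ⟨Q, hQ⟩
  rw [secondDeriv, dif_pos h]
  exact h.choose_spec

theorem norms_le_one_of_c2Norm_le_one (hf : c2Norm X f ≤ 1) (hx : x ∈ X) :
    |f x| ≤ 1 ∧ ‖firstDeriv X f x‖ ≤ 1 ∧ ‖secondDeriv X f x‖ ≤ 1 := by
  have h := (iSup₂_le_iff.1 hf) x hx
  rw [max_le_iff, max_le_iff] at h
  simp only [← ofReal_norm, ← ENNReal.ofReal_one, ENNReal.ofReal_le_ofReal_iff zero_le_one] at h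
  exact h

theorem norm_tangentProj_le (v : E) : ‖tangentProj X x v‖ ≤ ‖v‖ :=
  Submodule.norm_orthogonalProjectionOnto_apply_le _ v

variable {p : ℕ} {F : (Fin p → ℝ) → E}

theorem fderiv_comp_zero (hf : IsC2On X f) (hF : IsC2MapInto X F) {y : E} (hy : F 0 = y)
    (w : Fin p → ℝ) :
    fderiv ℝ (fun u => f (F u)) 0 w =
      firstDeriv X f y (tangentProj X y (fderiv ℝ F 0 w)) :=
  isFirstDerivAt_firstDeriv hf (hy ▸ hF.2 0) p F hF hy w

theorem norm_fderiv_comp_le (hf : IsC2On X f) (hf1 : c2Norm X f ≤ 1) (hF : IsC2MapInto X F) :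
    ‖fderiv ℝ (fun u => f (F u)) 0‖ ≤ ‖fderiv ℝ F 0‖ := by
  refine ContinuousLinearMap.opNorm_le_bound _ (norm_nonneg _) fun w => ?_
  rw [fderiv_comp_zero hf hF rfl]
  calc _ ≤ ‖firstDeriv X f (F 0)‖ * ‖tangentProj X (F 0) (fderiv ℝ F 0 w)‖ :=
        ContinuousLinearMap.le_opNorm _ _
    _ ≤ 1 * (‖fderiv ℝ F 0‖ * ‖w‖) := by
        refine mul_le_mul (norms_le_one_of_c2Norm_le_one hf1 (hF.2 0)).2.1
          ((norm_tangentProj_le _).trans (ContinuousLinearMap.le_opNorm _ _)) (norm_nonneg _)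
          zero_le_one
    _ = _ := one_mul _

theorem norm_fderiv_fderiv_comp_zero_le (hf : IsC2On X f) (hf1 : c2Norm X f ≤ 1)
    (hF : IsC2MapInto X F) :
    ‖fderiv ℝ (fderiv ℝ fun u => f (F u)) 0‖ ≤
      ‖fderiv ℝ F 0‖ ^ 2 + ‖fderiv ℝ (fderiv ℝ F) 0‖ := by
  obtain ⟨-, hL, hQ⟩ := norms_le_one_of_c2Norm_le_one hf1 (hF.2 0)
  refine ContinuousLinearMap.opNorm_le_bound₂ _ (by positivity) fun w w' => ?_
  rw [isSecondDerivAt_secondDeriv hf (hF.2 0) p F hF rfl w w']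
  have hv : ∀ v, ‖tangentProj X (F 0) (fderiv ℝ F 0 v)‖ ≤ ‖fderiv ℝ F 0‖ * ‖v‖ := fun v =>
    (norm_tangentProj_le _).trans (ContinuousLinearMap.le_opNorm _ _)
  have h1 : ‖secondDeriv X f (F 0) (tangentProj X (F 0) (fderiv ℝ F 0 w))
      (tangentProj X (F 0) (fderiv ℝ F 0 w'))‖ ≤
        1 * (‖fderiv ℝ F 0‖ * ‖w‖) * (‖fderiv ℝ F 0‖ * ‖w'‖) :=
    (ContinuousLinearMap.le_opNorm₂ _ _ _).trans (by gcongr <;> apply hv)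
  have h2 : ‖firstDeriv X f (F 0) (tangentProj X (F 0) (fderiv ℝ (fderiv ℝ F) 0 w w'))‖ ≤
      1 * (‖fderiv ℝ (fderiv ℝ F) 0‖ * ‖w‖ * ‖w'‖) :=
    (ContinuousLinearMap.le_opNorm _ _).trans (by
      gcongr
      exact (norm_tangentProj_le _).trans (ContinuousLinearMap.le_opNorm₂ _ _ _))
  refine (norm_add_le _ _).trans ((add_le_add h1 h2).trans (le_of_eq ?_))
  ring

theorem norm_fderiv_fderiv_comp_le (hf : IsC2On X f) (hf1 : c2Norm X f ≤ 1)
    (hF : IsC2MapInto X F) (u : Fin p → ℝ) :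
    ‖fderiv ℝ (fderiv ℝ fun u => f (F u)) u‖ ≤
      ‖fderiv ℝ F u‖ ^ 2 + ‖fderiv ℝ (fderiv ℝ F) u‖ := by
  have hFu : IsC2MapInto X (fun v => F (u + v)) :=
    ⟨hF.1.comp (contDiff_const.add contDiff_id), fun v => hF.2 _⟩
  have h := norm_fderiv_fderiv_comp_zero_le hf hf1 hFu
  have h1 : fderiv ℝ (fun v => f (F (u + v))) = fun v => fderiv ℝ (fun u => f (F u)) (u + v) :=
    funext fun v => fderiv_comp_add_left (f := fun u => f (F u)) u
  have h2 : fderiv ℝ (fun v => F (u + v)) = fun v => fderiv ℝ F (u + v) :=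
    funext fun v => fderiv_comp_add_left u
  rw [h1, h2, fderiv_comp_add_left, fderiv_comp_add_left] at h
  simpa only [add_zero] using h

end Calculus

/-! ### Taylor estimates, uniform over a compact set of parameters -/

section Taylor

theorem norm_sub_sub_fderiv_le {E : Type*} [NormedAddCommGroup E] [NormedSpace ℝ E] {G : E → ℝ}
    (hG : ContDiff ℝ 2 G) {K : ℝ}
    (hK : ∀ u, ‖u‖ ≤ 1 → ‖fderiv ℝ (fderiv ℝ G) u‖ ≤ K) {u : E} (hu : ‖u‖ ≤ 1) :
    |G u - G 0 - fderiv ℝ G 0 u| ≤ K * ‖u‖ ^ 2 := by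
  have hK0 : 0 ≤ K := (norm_nonneg _).trans (hK u hu)
  have hDG : Differentiable ℝ (fderiv ℝ G) :=
    (hG.fderiv_right (m := 1) (by norm_num)).differentiable one_ne_zero
  have h0 : (0 : E) ∈ Metric.closedBall (0 : E) ‖u‖ := Metric.mem_closedBall_self (norm_nonneg u)
  have hmem : ∀ v ∈ Metric.closedBall (0 : E) ‖u‖, ‖v‖ ≤ ‖u‖ := fun v hv => by simpa using hv
  have h1 : ∀ v ∈ Metric.closedBall (0 : E) ‖u‖, ‖fderiv ℝ G v - fderiv ℝ G 0‖ ≤ K * ‖u‖ := by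
    intro v hv
    refine ((convex_closedBall (0 : E) ‖u‖).norm_image_sub_le_of_norm_fderiv_le
      (fun w _ => hDG w) (fun w hw => hK w ((hmem w hw).trans hu)) h0 hv).trans ?_
    rw [sub_zero]
    exact mul_le_mul_of_nonneg_left (hmem v hv) hK0
  have h2 := (convex_closedBall (0 : E) ‖u‖).norm_image_sub_le_of_norm_fderiv_le'
    (fun w _ => hG.differentiable two_ne_zero w) h1 h0 (show u ∈ _ by simp)
  rw [sub_zero, Real.norm_eq_abs] at h2
  exact h2.trans_eq (by ring)

/-- A bound on the second derivative in the unit ball suffices for a quadratic Taylor remainder on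
the whole space, if the function is bounded.  The exponential times are unbounded, so that the
estimate is needed far from `0` too. -/
theorem abs_sub_sub_fderiv_le_of_bounded {E : Type*} [NormedAddCommGroup E] [NormedSpace ℝ E]
    {G : E → ℝ} (hG : ContDiff ℝ 2 G) (hG1 : ∀ u, |G u| ≤ 1) {K K' : ℝ}
    (hK : ∀ u, ‖u‖ ≤ 1 → ‖fderiv ℝ (fderiv ℝ G) u‖ ≤ K) (hK' : ‖fderiv ℝ G 0‖ ≤ K') (u : E) :
    |G u - G 0 - fderiv ℝ G 0 u| ≤ (K + K' + 2) * ‖u‖ ^ 2 := by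
  have hK0 : 0 ≤ K := (norm_nonneg _).trans (hK 0 (by simp))
  have hK0' : 0 ≤ K' := (norm_nonneg _).trans hK'
  rcases le_total ‖u‖ 1 with hu | hu
  · refine (norm_sub_sub_fderiv_le hG hK hu).trans ?_
    gcongr
    linarith
  · -- Far from `0` the quadratic bound is weaker than the trivial one.
    have h1 : |fderiv ℝ G 0 u| ≤ K' * ‖u‖ := (fderiv ℝ G 0).le_of_opNorm_le hK' u
    have h2 : |G u - G 0 - fderiv ℝ G 0 u| ≤ 1 + 1 + K' * ‖u‖ :=
      (abs_sub _ _).trans (add_le_add ((abs_sub _ _).trans (add_le_add (hG1 u) (hG1 0))) h1)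
    nlinarith [mul_nonneg hK0' (sub_nonneg.2 hu), mul_nonneg hK0 (sq_nonneg ‖u‖), sq_nonneg ‖u‖,
      mul_nonneg (mul_nonneg hK0' (sub_nonneg.2 hu)) (norm_nonneg u)]

/-- Along a `C^2` family of maps into `X`, with parameters in a compact set, the functions `f` on
`X` with `‖f‖_2 ≤ 1` have a uniform second order Taylor estimate at `0`. -/
theorem exists_taylor_bound {Q E : Type*} [NormedAddCommGroup Q] [NormedSpace ℝ Q]
    [NormedAddCommGroup E] [InnerProductSpace ℝ E] [FiniteDimensional ℝ E] {p : ℕ}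
    {Θ : Q → (Fin p → ℝ) → E} (hΘ : ContDiff ℝ 2 (Function.uncurry Θ)) {S : Set Q}
    (hS : IsCompact S) (X : Set E) :
    ∃ C : ℝ, 0 ≤ C ∧ ∀ q ∈ S, (∀ u, Θ q u ∈ X) → ∀ f, IsC2On X f → c2Norm X f ≤ 1 → ∀ u,
      |f (Θ q u) - f (Θ q 0) - fderiv ℝ (fun u => f (Θ q u)) 0 u| ≤ C * ‖u‖ ^ 2 := by
  have hD1 : ContDiff ℝ 1 (fun z : Q × (Fin p → ℝ) => fderiv ℝ (Θ z.1) z.2) :=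
    ContDiff.fderiv (f := fun z : Q × (Fin p → ℝ) => Θ z.1)
      (hΘ.comp ((contDiff_fst.comp contDiff_fst).prodMk contDiff_snd)) contDiff_snd (by norm_num)
  have hD2 : ContDiff ℝ 0 (fun z : Q × (Fin p → ℝ) => fderiv ℝ (fderiv ℝ (Θ z.1)) z.2) :=
    ContDiff.fderiv (f := fun z : Q × (Fin p → ℝ) => fderiv ℝ (Θ z.1)) (m := 1)
      (hD1.comp ((contDiff_fst.comp contDiff_fst).prodMk contDiff_snd)) contDiff_snd (by norm_num)
  have hcomp : IsCompact (S ×ˢ Metric.closedBall (0 : Fin p → ℝ) 1) :=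
    hS.prod (isCompact_closedBall _ _)
  obtain ⟨K₁, hK₁⟩ := hcomp.exists_bound_of_continuousOn hD1.continuous.continuousOn
  obtain ⟨K₂, hK₂⟩ := hcomp.exists_bound_of_continuousOn hD2.continuous.continuousOn
  refine ⟨|K₁| ^ 2 + |K₂| + |K₁| + 2, by positivity, fun q hq hqX f hf hf1 u => ?_⟩
  have hF : IsC2MapInto X (Θ q) :=
    ⟨hΘ.comp (contDiff_const.prodMk contDiff_id), hqX⟩
  have hb₁ : ∀ v, ‖v‖ ≤ 1 → ‖fderiv ℝ (Θ q) v‖ ≤ |K₁| := fun v hv =>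
    (hK₁ (q, v) ⟨hq, by simpa using hv⟩).trans (le_abs_self _)
  have hb₂ : ∀ v, ‖v‖ ≤ 1 → ‖fderiv ℝ (fderiv ℝ (Θ q)) v‖ ≤ |K₂| := fun v hv =>
    (hK₂ (q, v) ⟨hq, by simpa using hv⟩).trans (le_abs_self _)
  refine abs_sub_sub_fderiv_le_of_bounded (G := fun u => f (Θ q u)) (hf.1 p _ hF)
    (fun v => (norms_le_one_of_c2Norm_le_one hf1 (hqX v)).1) (fun v hv => ?_)
    ((norm_fderiv_comp_le hf hf1 hF).trans (hb₁ 0 (by simp))) u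
  refine (norm_fderiv_fderiv_comp_le hf hf1 hF v).trans ?_
  gcongr
  exacts [hb₁ v hv, hb₂ v hv]

end Taylor

/-! ### Moments of the exponential times -/

section Exponential

theorem measurable_gammaPDF_one : Measurable (gammaPDF 1 1) :=
  (measurable_gammaPDFReal 1 1).ennreal_ofReal

theorem gammaPDF_one_smul (g : ℝ → ℝ) :
    (fun x => (gammaPDF 1 1 x).toReal • g x) =
      (Ici (0 : ℝ)).indicator fun x => Real.exp (-x) * g x := by
  funext x
  rw [show gammaPDF 1 1 x = exponentialPDF 1 x from rfl, exponentialPDF_eq]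
  by_cases hx : 0 ≤ x
  · rw [indicator_of_mem (show x ∈ Ici 0 from hx), if_pos hx,
      ENNReal.toReal_ofReal (by positivity), one_mul, one_mul, smul_eq_mul]
  · rw [indicator_of_notMem (show x ∉ Ici 0 from hx), if_neg hx]
    simp

theorem integrable_pow_expMeasure (k : ℕ) : Integrable (fun x : ℝ => x ^ k) (expMeasure 1) := by
  rw [expMeasure, gammaMeasure, integrable_withDensity_iff_integrable_smul'
    measurable_gammaPDF_one (ae_of_all _ fun _ => ENNReal.ofReal_lt_top),
    gammaPDF_one_smul, integrable_indicator_iff measurableSet_Ici,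
    integrableOn_Ici_iff_integrableOn_Ioi]
  have h := Real.GammaIntegral_convergent (s := k + 1) (by positivity)
  simpa using h

theorem integral_expMeasure_one : ∫ x : ℝ, x ∂expMeasure 1 = 1 := by
  rw [expMeasure, gammaMeasure, integral_withDensity_eq_integral_toReal_smul
    measurable_gammaPDF_one (ae_of_all _ fun _ => ENNReal.ofReal_lt_top),
    gammaPDF_one_smul, integral_indicator measurableSet_Ici, integral_Ici_eq_integral_Ioi]
  have h := Real.Gamma_eq_integral (s := 2) two_pos
  rw [Real.Gamma_two] at h
  rw [h]
  norm_num

end Exponential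

section ExponentialVector

variable {n : ℕ}

instance isProbabilityMeasure_expMeasure_one : IsProbabilityMeasure (expMeasure 1) :=
  isProbabilityMeasure_expMeasure one_pos

theorem integrable_id_pi_expMeasure :
    Integrable (fun τ : Fin n → ℝ => τ) (Measure.pi fun _ : Fin n => expMeasure 1) :=
  Integrable.of_eval fun k => integrable_comp_eval (X := fun _ : Fin n => ℝ)
    (μ := fun _ => expMeasure 1) (i := k) (f := fun x : ℝ => x)
    (by simpa using integrable_pow_expMeasure 1)

theorem integral_id_pi_expMeasure :
    ∫ τ : Fin n → ℝ, τ ∂(Measure.pi fun _ : Fin n => expMeasure 1) = 1 := by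
  funext k
  rw [eval_integral (fun k => integrable_id_pi_expMeasure.eval k),
    integral_comp_eval (X := fun _ : Fin n => ℝ) (μ := fun _ => expMeasure 1) (i := k)
      (f := fun x : ℝ => x) aestronglyMeasurable_id, integral_expMeasure_one]
  rfl

theorem integrable_sum_sq_pi_expMeasure :
    Integrable (fun τ : Fin n → ℝ => ∑ k, τ k ^ 2) (Measure.pi fun _ : Fin n => expMeasure 1) :=
  integrable_finsetSum _ fun k _ => integrable_comp_eval (X := fun _ : Fin n => ℝ)
    (μ := fun _ => expMeasure 1) (i := k) (f := fun x : ℝ => x ^ 2) (integrable_pow_expMeasure 2)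

theorem norm_sq_le_sum_sq (τ : Fin n → ℝ) : ‖τ‖ ^ 2 ≤ ∑ k, τ k ^ 2 := by
  have h : ‖τ‖ ≤ Real.sqrt (∑ k, τ k ^ 2) := by
    refine (pi_norm_le_iff_of_nonneg (Real.sqrt_nonneg _)).2 fun k => ?_
    rw [Real.norm_eq_abs]
    exact Real.abs_le_sqrt (Finset.single_le_sum (f := fun k => τ k ^ 2)
      (fun j _ => sq_nonneg (τ j)) (Finset.mem_univ k))
  calc ‖τ‖ ^ 2 ≤ Real.sqrt (∑ k, τ k ^ 2) ^ 2 := by gcongr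
    _ = _ := Real.sq_sqrt (Finset.sum_nonneg fun k _ => sq_nonneg _)

/-- A function with a quadratic Taylor remainder, averaged over the times `h τ`. -/
theorem abs_integral_sub_le {G : (Fin n → ℝ) → ℝ} (hG : Continuous G) (hG1 : ∀ u, |G u| ≤ 1)
    (l : (Fin n → ℝ) →L[ℝ] ℝ) {C : ℝ} (hC : 0 ≤ C)
    (hGl : ∀ u, |G u - G 0 - l u| ≤ C * ‖u‖ ^ 2) (h : ℝ) :
    |∫ τ : Fin n → ℝ, G (fun k => h * τ k) ∂(Measure.pi fun _ : Fin n => expMeasure 1)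
        - G 0 - h * l 1| ≤
      C * h ^ 2 * ∫ τ : Fin n → ℝ, ∑ k, τ k ^ 2 ∂(Measure.pi fun _ : Fin n => expMeasure 1) := by
  set μ : Measure (Fin n → ℝ) := Measure.pi fun _ : Fin n => expMeasure 1
  have hint : Integrable (fun τ : Fin n → ℝ => G (fun k => h * τ k)) μ := by
    refine Integrable.of_bound (Continuous.aestronglyMeasurable (by fun_prop)) 1
      (ae_of_all _ fun τ => ?_)
    exact hG1 _
  have hl : Integrable (fun τ : Fin n → ℝ => h * l τ) μ :=
    (l.integrable_comp integrable_id_pi_expMeasure).const_mul h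
  have hl1 : ∫ τ, h * l τ ∂μ = h * l 1 := by
    rw [integral_const_mul, l.integral_comp_comm integrable_id_pi_expMeasure,
      integral_id_pi_expMeasure]
  have heq : ∫ τ, G (fun k => h * τ k) ∂μ - G 0 - h * l 1 =
      ∫ τ, (G (fun k => h * τ k) - G 0 - h * l τ) ∂μ := by
    have hint' : Integrable (fun τ : Fin n → ℝ => G (fun k => h * τ k) - G 0) μ :=
      hint.sub (integrable_const _)
    rw [integral_sub hint' hl, integral_sub hint (integrable_const _), hl1]
    simp
  rw [heq, ← integral_const_mul, ← Real.norm_eq_abs]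
  refine norm_integral_le_of_norm_le (integrable_sum_sq_pi_expMeasure.const_mul _)
    (ae_of_all _ fun τ => ?_)
  have h1 : (fun k => h * τ k) = h • τ := rfl
  have h2 := hGl (h • τ)
  rw [map_smul, smul_eq_mul, norm_smul, mul_pow, Real.norm_eq_abs, sq_abs, ← mul_assoc] at h2
  rw [h1, Real.norm_eq_abs]
  exact h2.trans (mul_le_mul_of_nonneg_left (norm_sq_le_sum_sq τ) (by positivity))

end ExponentialVector

/-! ### The local error -/

section LocalError

variable {d n : ℕ} {V : Fin n → Space d → Space d}

theorem fderiv_apply_of_curve {E F : Type*} [NormedAddCommGroup E] [NormedSpace ℝ E]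
    [NormedAddCommGroup F] [NormedSpace ℝ F] {G : E → F} (hG : DifferentiableAt ℝ G 0) (v : E)
    {w : F} (hw : HasDerivAt (fun r : ℝ => G (r • v)) w 0) : fderiv ℝ G 0 v = w := by
  have h1 : HasFDerivAt G (fderiv ℝ G 0) ((0 : ℝ) • v) := by
    rw [zero_smul]
    exact hG.hasFDerivAt
  have h2 := h1.comp_hasDerivAt (0 : ℝ) ((hasDerivAt_id (0 : ℝ)).smul_const v)
  rw [one_smul] at h2
  exact h2.unique hw

/-- `P_h` and the true dynamics over the time `h` agree to first order, because a cycle has the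
velocity `V k` in the direction of its `k`-th time and all times have mean one.  The estimate is
uniform over the functions `S_s f` with `s ≤ t`. -/
theorem exists_local_error_bound (hC2 : ∀ k, ContDiff ℝ 2 (V k)) (hc : ∀ k, IsComplete (V k))
    {x₀ : Space d} (hb : Bornology.IsBounded (orbit V x₀)) {W : Space d → Space d}
    (hW : ContDiff ℝ 2 W) (hWc : IsComplete W) (hWV : ∀ x ∈ orbit V x₀, W x = totalField V x)
    (hinv : ∀ x ∈ orbit V x₀, ∀ t, flow W t x ∈ orbit V x₀) (t : ℝ) :
    ∃ C : ℝ, 0 ≤ C ∧ ∀ f, IsC2On (orbit V x₀) f → c2Norm (orbit V x₀) f ≤ 1 →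
      ∀ x ∈ orbit V x₀, ∀ s ∈ Icc 0 t, ∀ h : ℝ,
        |transitionOp V h (fun y => f (flow W s y)) x - f (flow W (s + h) x)| ≤ C * h ^ 2 := by
  set X := orbit V x₀
  have hΨ := contDiff_flow two_ne_zero hW hWc
  have hΦ := contDiff_cycle hC2 hc
  let Θ₁ : ℝ × Space d → (Fin n → ℝ) → Space d := fun q u => flow W q.1 (cycle V u q.2)
  let Θ₂ : ℝ × Space d → (Fin 1 → ℝ) → Space d := fun q r => flow W q.1 (flow W (r 0) q.2)
  have hΘ₁ : ContDiff ℝ 2 (Function.uncurry Θ₁) :=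
    hΨ.comp ((contDiff_fst.comp contDiff_fst).prodMk
      (hΦ.comp (contDiff_snd.prodMk (contDiff_snd.comp contDiff_fst))))
  have hΘ₂ : ContDiff ℝ 2 (Function.uncurry Θ₂) :=
    hΨ.comp ((contDiff_fst.comp contDiff_fst).prodMk
      (hΨ.comp (((contDiff_apply ℝ ℝ 0).comp contDiff_snd).prodMk
        (contDiff_snd.comp contDiff_fst))))
  have hS : IsCompact (Icc 0 t ×ˢ closure X) := isCompact_Icc.prod hb.isCompact_closure
  obtain ⟨C₁, hC₁, htaylor₁⟩ := exists_taylor_bound hΘ₁ hS X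
  obtain ⟨C₂, hC₂, htaylor₂⟩ := exists_taylor_bound hΘ₂ hS X
  set M := ∫ τ : Fin n → ℝ, ∑ k, τ k ^ 2 ∂(Measure.pi fun _ : Fin n => expMeasure 1)
  have hM : 0 ≤ M := integral_nonneg fun τ => Finset.sum_nonneg fun k _ => sq_nonneg _
  refine ⟨C₁ * M + C₂, by positivity, fun f hf hf1 x hx s hs h => ?_⟩
  have hmem : (s, x) ∈ Icc 0 t ×ˢ closure X := ⟨hs, subset_closure hx⟩
  have hF₁ : IsC2MapInto X (Θ₁ (s, x)) :=
    ⟨hΘ₁.comp (contDiff_const.prodMk contDiff_id), fun u => hinv _ (cycle_mem_orbit hx u) s⟩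
  have hF₂ : IsC2MapInto X (Θ₂ (s, x)) :=
    ⟨hΘ₂.comp (contDiff_const.prodMk contDiff_id), fun r => hinv _ (hinv x hx _) s⟩
  have h₁0 : Θ₁ (s, x) 0 = flow W s x := by simp only [Θ₁, cycle_zero hc]
  have h₂0 : Θ₂ (s, x) 0 = flow W s x := by simp only [Θ₂, Pi.zero_apply, flow_zero hWc]
  have hs' : ContDiff ℝ 2 (flow W s) := hΨ.comp (contDiff_const.prodMk contDiff_id)
  set A := fderiv ℝ (flow W s) x
  have hA : HasFDerivAt (flow W s) A x := (hs'.differentiable two_ne_zero x).hasFDerivAt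
  have hderiv₁ : ∀ k, fderiv ℝ (Θ₁ (s, x)) 0 (Pi.single k 1) = A (V k x) := by
    intro k
    refine fderiv_apply_of_curve (hF₁.1.differentiable two_ne_zero 0) _ ?_
    have h1 : HasFDerivAt (flow W s) A (flow (V k) 0 x) := by rwa [flow_zero (hc k)]
    have h2 := h1.comp_hasDerivAt (0 : ℝ) (hasDerivAt_flow (hc k) x 0)
    rw [flow_zero (hc k)] at h2
    refine h2.congr_of_eventuallyEq (Eventually.of_forall fun r => ?_)
    simp only [Θ₁, Function.comp_apply]
    rw [← Pi.single_smul, smul_eq_mul, mul_one, cycle_single hc]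
  have hderiv₂ : fderiv ℝ (Θ₂ (s, x)) 0 1 = A (totalField V x) := by
    refine fderiv_apply_of_curve (hF₂.1.differentiable two_ne_zero 0) _ ?_
    have h1 : HasFDerivAt (flow W s) A (flow W 0 x) := by rwa [flow_zero hWc]
    have h2 := h1.comp_hasDerivAt (0 : ℝ) (hasDerivAt_flow hWc x 0)
    rw [flow_zero hWc, hWV x hx] at h2
    refine h2.congr_of_eventuallyEq (Eventually.of_forall fun r => ?_)
    simp [Θ₂]
  set l₁ := fderiv ℝ (fun u => f (Θ₁ (s, x) u)) 0
  set l₂ := fderiv ℝ (fun u => f (Θ₂ (s, x) u)) 0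
  have hl : l₁ 1 = l₂ 1 := by
    have h1 : (1 : Fin n → ℝ) = ∑ k, Pi.single k 1 := (Finset.univ_sum_single 1).symm
    have h2 : fderiv ℝ (Θ₁ (s, x)) 0 1 = fderiv ℝ (Θ₂ (s, x)) 0 1 := by
      rw [hderiv₂, h1, map_sum, totalField, map_sum]
      exact Finset.sum_congr rfl fun k _ => hderiv₁ k
    rw [fderiv_comp_zero hf hF₁ h₁0, fderiv_comp_zero hf hF₂ h₂0, h2]
  have herr₁ := abs_integral_sub_le (G := fun u => f (Θ₁ (s, x) u)) (hf.1 n _ hF₁).continuous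
    (fun u => (norms_le_one_of_c2Norm_le_one hf1 (hF₁.2 u)).1) l₁ hC₁
    (htaylor₁ (s, x) hmem hF₁.2 f hf hf1) h
  have herr₂ := htaylor₂ (s, x) hmem hF₂.2 f hf hf1 (h • 1)
  have hflow : Θ₂ (s, x) (h • 1) = flow W (s + h) x := by
    simp [Θ₂, flow_add (hW.of_le one_le_two) hWc]
  rw [hflow, map_smul, smul_eq_mul, norm_smul, mul_pow, Real.norm_eq_abs, sq_abs, norm_one,
    one_pow, mul_one, h₂0] at herr₂
  rw [h₁0, hl] at herr₁
  have hP : transitionOp V h (fun y => f (flow W s y)) x =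
      ∫ τ : Fin n → ℝ, f (Θ₁ (s, x) fun k => h * τ k)
        ∂(Measure.pi fun _ : Fin n => expMeasure 1) := rfl
  rw [← hP] at herr₁
  have htri := abs_sub_le (transitionOp V h (fun y => f (flow W s y)) x)
    (f (flow W s x) + h * l₂ 1) (f (flow W (s + h) x))
  rw [← sub_sub, abs_sub_comm (f (flow W s x) + h * l₂ 1), ← sub_sub] at htri
  calc _ ≤ C₁ * h ^ 2 * M + C₂ * h ^ 2 := htri.trans (add_le_add herr₁ herr₂)
    _ = _ := by ring

end LocalError

/-! ### Accumulation of the local errors -/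

section Iteration

variable {d n : ℕ} {V : Fin n → Space d → Space d}

/-- A function is admissible on `X` if it is bounded by one there and continuous along all `C^2`
maps into `X`.  For such functions on an orbit the integral that defines `P_h` converges. -/
def IsAdmissible {E : Type*} [NormedAddCommGroup E] [NormedSpace ℝ E] (X : Set E)
    (g : E → ℝ) : Prop :=
  (∀ x ∈ X, |g x| ≤ 1) ∧ ∀ (p : ℕ) (F : (Fin p → ℝ) → E), ContDiff ℝ 2 F → (∀ u, F u ∈ X) →
    Continuous fun u => g (F u)

theorem IsAdmissible.integrable_comp_cycle (hC2 : ∀ k, ContDiff ℝ 2 (V k))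
    (hc : ∀ k, IsComplete (V k)) {x₀ : Space d} {g : Space d → ℝ}
    (hg : IsAdmissible (orbit V x₀) g) (h : ℝ) {x : Space d} (hx : x ∈ orbit V x₀) :
    Integrable (fun τ : Fin n → ℝ => g (cycle V (fun k => h * τ k) x))
      (Measure.pi fun _ : Fin n => expMeasure 1) := by
  have hF : ContDiff ℝ 2 fun τ : Fin n → ℝ => cycle V (fun k => h * τ k) x :=
    (contDiff_cycle hC2 hc).comp ((contDiff_const_smul h).prodMk contDiff_const)
  exact Integrable.of_bound
    (hg.2 n _ hF fun τ => cycle_mem_orbit hx _).aestronglyMeasurable 1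
    (ae_of_all _ fun τ => hg.1 _ (cycle_mem_orbit hx _))

theorem IsAdmissible.transitionOp (hC2 : ∀ k, ContDiff ℝ 2 (V k))
    (hc : ∀ k, IsComplete (V k)) {x₀ : Space d} {g : Space d → ℝ}
    (hg : IsAdmissible (orbit V x₀) g) (h : ℝ) :
    IsAdmissible (orbit V x₀) (transitionOp V h g) := by
  refine ⟨fun x hx => ?_, fun p F hF hFX => ?_⟩
  · have h1 := norm_integral_le_of_norm_le_const (C := 1)
      (f := fun τ : Fin n → ℝ => g (cycle V (fun k => h * τ k) x))
      (μ := Measure.pi fun _ : Fin n => expMeasure 1) (ae_of_all _ fun τ : Fin n → ℝ =>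
        hg.1 _ (cycle_mem_orbit hx (V := V) fun k => h * τ k))
    rw [probReal_univ, mul_one] at h1
    exact h1
  · have hjoint : Continuous fun z : (Fin p → ℝ) × (Fin n → ℝ) =>
        g (cycle V (fun k => h * z.2 k) (F z.1)) := by
      -- Admissibility gives joint continuity once the pair of arguments is written as one vector.
      let l : (Fin (p + n) → ℝ) →L[ℝ] (Fin p → ℝ) :=
        ContinuousLinearMap.pi fun i => ContinuousLinearMap.proj (Fin.castAdd n i)
      let r : (Fin (p + n) → ℝ) →L[ℝ] (Fin n → ℝ) :=
        ContinuousLinearMap.pi fun i => ContinuousLinearMap.proj (Fin.natAdd p i)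
      have hFr : ContDiff ℝ 2 fun w : Fin (p + n) → ℝ => cycle V (fun k => h * r w k) (F (l w)) :=
        (contDiff_cycle hC2 hc).comp
          (((contDiff_const_smul h).comp r.contDiff).prodMk (hF.comp l.contDiff))
      have h1 := (hg.2 _ _ hFr fun w => cycle_mem_orbit (hFX _) _).comp
        (Fin.continuous_append (X := ℝ) p n)
      convert! h1 using 2 with z
      simp [l, r]
    refine continuous_of_dominated (bound := fun _ => 1) (fun u => ?_) (fun u => ?_)
      (integrable_const _) (ae_of_all _ fun τ => ?_)
    · exact (hjoint.comp (Continuous.prodMk_right u)).aestronglyMeasurable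
    · exact ae_of_all _ fun τ => hg.1 _ (cycle_mem_orbit (hFX u) _)
    · exact hjoint.comp (Continuous.prodMk_left τ)

theorem abs_transitionOp_sub_le (hC2 : ∀ k, ContDiff ℝ 2 (V k))
    (hc : ∀ k, IsComplete (V k)) {x₀ : Space d} {g g' : Space d → ℝ}
    (hg : IsAdmissible (orbit V x₀) g) (hg' : IsAdmissible (orbit V x₀) g') {ε : ℝ}
    (hgg' : ∀ x ∈ orbit V x₀, |g x - g' x| ≤ ε) (h : ℝ) {x : Space d} (hx : x ∈ orbit V x₀) :
    |transitionOp V h g x - transitionOp V h g' x| ≤ ε := by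
  rw [transitionOp, transitionOp, ← integral_sub (hg.integrable_comp_cycle hC2 hc h hx)
    (hg'.integrable_comp_cycle hC2 hc h hx)]
  have h1 := norm_integral_le_of_norm_le_const (C := ε)
    (f := fun τ : Fin n → ℝ =>
      g (cycle V (fun k => h * τ k) x) - g' (cycle V (fun k => h * τ k) x))
    (μ := Measure.pi fun _ : Fin n => expMeasure 1) (ae_of_all _ fun τ : Fin n → ℝ =>
      hgg' _ (cycle_mem_orbit hx (V := V) fun k => h * τ k))
  rw [probReal_univ, mul_one] at h1
  exact h1

theorem abs_iterate_transitionOp_sub_le (hC2 : ∀ k, ContDiff ℝ 2 (V k))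
    (hc : ∀ k, IsComplete (V k)) {x₀ : Space d} {W : Space d → Space d}
    (hW : ContDiff ℝ 2 W) (hWc : IsComplete W)
    (hinv : ∀ x ∈ orbit V x₀, ∀ t, flow W t x ∈ orbit V x₀) {f : Space d → ℝ}
    (hf : IsAdmissible (orbit V x₀) f) {h t C : ℝ} (hh : 0 ≤ h)
    (hC : ∀ x ∈ orbit V x₀, ∀ s ∈ Icc 0 t,
      |transitionOp V h (fun y => f (flow W s y)) x - f (flow W (s + h) x)| ≤ C * h ^ 2)
    (m : ℕ) (hm : m * h ≤ t) :
    IsAdmissible (orbit V x₀) ((transitionOp V h)^[m] f) ∧ ∀ x ∈ orbit V x₀,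
      |(transitionOp V h)^[m] f x - f (flow W (m * h) x)| ≤ m * (C * h ^ 2) := by
  induction m with
  | zero => exact ⟨hf, fun x _ => by simp [flow_zero hWc]⟩
  | succ m ih =>
    have hm' : (m : ℝ) * h ≤ t := le_trans (by push_cast; nlinarith) hm
    obtain ⟨hadm, hle⟩ := ih hm'
    rw [Function.iterate_succ_apply']
    refine ⟨hadm.transitionOp hC2 hc h, fun x hx => ?_⟩
    have hflow : ContDiff ℝ 2 (flow W (m * h)) :=
      (contDiff_flow two_ne_zero hW hWc).comp (contDiff_const.prodMk contDiff_id)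
    have hadm' : IsAdmissible (orbit V x₀) (fun y => f (flow W (m * h) y)) :=
      ⟨fun y hy => hf.1 _ (hinv y hy _), fun p F hF hFX =>
        hf.2 p _ (hflow.comp hF) fun u => hinv _ (hFX u) _⟩
    have h1 := abs_transitionOp_sub_le hC2 hc hadm hadm' hle h hx
    have h2 := hC x hx (m * h) ⟨by positivity, hm'⟩
    have h3 : ((m + 1 : ℕ) : ℝ) * h = m * h + h := by push_cast; ring
    rw [h3]
    refine (abs_sub_le _ _ _).trans ((add_le_add h1 h2).trans_eq ?_)
    push_cast
    ring

end Iteration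

end RandomSplitting

theorem theorem4p2 {d n : ℕ} (V : Fin n → RandomSplitting.Space d → RandomSplitting.Space d)
    (hC2 : ∀ k, ContDiff ℝ 2 (V k))
    (hcomplete : ∀ k, RandomSplitting.IsComplete (V k))
    (hbounded : ∀ x, Bornology.IsBounded (RandomSplitting.orbit V x))
    (x₀ : RandomSplitting.Space d) (t : ℝ) (ht : 0 < t) :
    ∃ C h₀ : ℝ, 0 < h₀ ∧
      ∀ (h : ℝ) (m : ℕ), 0 < h → h < h₀ → (m : ℝ) * h = t →
        RandomSplitting.opNormTwoZero (RandomSplitting.orbit V x₀)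
          (fun f => (RandomSplitting.transitionOp V h)^[m] f - RandomSplitting.trueSemigroup V t f)
          ≤ ENNReal.ofReal (C * h) := by
  open RandomSplitting in
  obtain ⟨W, hW, hWc, hWV, hinv, hflow⟩ := exists_complete_field hC2 hcomplete (hbounded x₀)
  obtain ⟨C, -, hC⟩ :=
    exists_local_error_bound hC2 hcomplete (hbounded x₀) hW hWc hWV hinv t
  refine ⟨C * t, 1, one_pos, fun h m hh _ hmt => ?_⟩
  refine iSup_le fun f => iSup_le fun hf => iSup_le fun hf1 => iSup₂_le fun x hx => ?_
  have hadm : IsAdmissible (orbit V x₀) f :=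
    ⟨fun y hy => (norms_le_one_of_c2Norm_le_one hf1.le hy).1,
      fun p F hF hFX => (hf.1 p F ⟨hF, hFX⟩).continuous⟩
  have herr := (abs_iterate_transitionOp_sub_le hC2 hcomplete hW hWc hinv hadm hh.le
    (fun y hy s hs => hC f hf hf1.le y hy s hs h) m hmt.le).2 x hx
  rw [Real.enorm_eq_ofReal_abs]
  refine ENNReal.ofReal_le_ofReal ?_
  rw [hmt, ← hflow x hx] at herr
  refine herr.trans_eq ?_
  rw [← hmt]
  ring
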